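/- Let $(T_n)_{n\ge 1}$ be a uniform random recursive tree process: $T_1$ consists of the single vertex $1$, and for each $n\ge 1$ the tree $T_{n+1}$, with vertex set $[n+1]=\{1,\dots,n+1\}$, is obtained from $T_n$ by adding the vertex $n+1$ and joining it by an edge to a vertex chosen uniformly at random from $[n]$, all choices being independent. For a vertex $v$ of $T_n$ let the betweenness centrality $\mathcal{B}_{T_n}(v)$ be the number of ordered pairs $(s,t)$ of vertices of $T_n$, both different from $v$, such that $v$ lies on the path between $s$ and $t$ in $T_n$. Vertices with larger $\mathcal{B}_{T_n}$ are more central, and among vertices with equal values of $\mathcal{B}_{T_n}$ those with larger label are more central. Let $I_n$ be the label of the most central vertex of $T_n$ (the betweenness center). Then $I_n$ is persistent: there exist almost surely finite integer-valued random variables $N$ and $K$ such that, almost surely, $I_n=K$ for all $n\ge N$. -/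

import Mathlib

namespace URRT

/-- The vertex set `[n] = {1, …, n}`. -/
abbrev Vertex (n : ℕ) : Type := ↥(Finset.Icc 1 n)

/-- The tree `T_n` on `[n]` grown from the attachment sequence `a`: starting from the single
vertex `1`, the vertex `m + 1` (for `m = 1, …, n - 1`) is joined by an edge to `a m`. -/
def tree (a : ℕ → ℕ) (n : ℕ) : SimpleGraph (Vertex n) :=
  SimpleGraph.fromRel fun u v => ∃ m : ℕ, 1 ≤ m ∧ (u : ℕ) = a m ∧ (v : ℕ) = m + 1

/-- `A` is a uniform attachment sequence on the probability space `(Ω, μ)`: for every `n ≥ 1`,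
the vertex `A n` to which `n + 1` is attached is uniformly distributed on `[n]`, and the choices
`A 1, A 2, …` are independent. (The value `A 0` is never used.) -/
structure IsUniformAttachment {Ω : Type*} [MeasurableSpace Ω]
    (μ : MeasureTheory.Measure Ω) (A : ℕ → Ω → ℕ) : Prop where
  measurable : ∀ n : ℕ, 1 ≤ n → Measurable (A n)
  uniform : ∀ n : ℕ, 1 ≤ n → ∀ i ∈ Finset.Icc 1 n, μ {ω | A n ω = i} = ((n : ENNReal))⁻¹
  indep : ProbabilityTheory.iIndepFun (fun k : ℕ => A (k + 1)) μ

/-- Betweenness centrality `B_T(v)` of a vertex `v` of a finite tree `T`: the number of pairs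
`(s, t)` of vertices distinct from `v` such that `v` lies on the (unique) path from `s` to `t`. -/
noncomputable def betweenness {V : Type*} (T : SimpleGraph V) (v : V) : ℕ :=
  {st : V × V | st.1 ≠ v ∧ st.2 ≠ v ∧
    ∃ p : T.Walk st.1 st.2, p.IsPath ∧ v ∈ p.support}.ncard

/-- `u` is more central than `v` for a score `ψ` whose larger values are more central; equal
scores are ordered pessimistically, the later vertex being more central. -/
def MoreCentral {n : ℕ} (ψ : Vertex n → ℕ) (u v : Vertex n) : Prop :=
  ψ v < ψ u ∨ (ψ u = ψ v ∧ (v : ℕ) < (u : ℕ))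

/-- The rank `γ_n(u)`, that is, one plus the number of vertices more central than `u`. -/
noncomputable def rank {n : ℕ} (ψ : Vertex n → ℕ) (u : Vertex n) : ℕ :=
  1 + {v : Vertex n | MoreCentral ψ v u}.ncard

theorem rank_eq_one_iff {n : ℕ} (ψ : Vertex n → ℕ) (u : Vertex n) :
    rank ψ u = 1 ↔ ∀ v, ¬ MoreCentral ψ v u := by
  unfold rank
  rw [Nat.add_eq_left, Set.ncard_eq_zero (Set.toFinite _), Set.eq_empty_iff_forall_notMem]
  rfl

/-- Exactly one vertex has rank one, so that the center is well defined. -/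
theorem existsUnique_rank_eq_one {n : ℕ} (hn : 1 ≤ n) (ψ : Vertex n → ℕ) :
    ∃! v : Vertex n, rank ψ v = 1 := by
  have : Nonempty (Vertex n) := ⟨⟨1, Finset.mem_Icc.2 ⟨le_rfl, hn⟩⟩⟩
  obtain ⟨u, hu⟩ := Finite.exists_max (fun v : Vertex n => toLex (ψ v, (v : ℕ)))
  simp only [rank_eq_one_iff, MoreCentral]
  simp only [Prod.Lex.toLex_le_toLex] at hu
  refine ⟨u, fun v => ?_, fun w hw => ?_⟩
  · have := hu v
    omega
  · have h1 := hw u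
    have h2 := hu w
    apply Subtype.ext
    omega

open Classical in
/-- The index of the center: the label of the vertex of rank one (and `0` for the empty tree). -/
noncomputable def centerIndex {n : ℕ} (ψ : Vertex n → ℕ) : ℕ :=
  if h : ∃ v : Vertex n, rank ψ v = 1 then (h.choose : ℕ) else 0

/-- The sequence of random variables `I` is persistent: almost surely `I n = K` for all `n ≥ N`,
for some (almost surely finite) integer-valued random variables `N` and `K`. -/
def Persistent {Ω : Type*} [MeasurableSpace Ω] (μ : MeasureTheory.Measure Ω)
    (I : ℕ → Ω → ℕ) : Prop :=
  ∃ N K : Ω → ℕ, Measurable N ∧ Measurable K ∧ ∀ᵐ ω ∂μ, ∀ n ≥ N ω, I n ω = K ω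

end URRT

/-! ### Ancestors, branches and pair counts of an attachment sequence -/

namespace URRT

open Finset

/-! Among the `(n - 1)^2` ordered pairs of vertices other than `v`, those not separated by `v` are
counted by `pairCount (SameBranch a v)`, so the center minimises this count
(`betweenness_add_pairCount`). When `n + 1` is attached to `i`, the count `P` grows by `2 * row +
1`, and the rows add up to `P`; hence `(P + n) / (n (n + 1))` is a bounded martingale
(`isAveraging_pairDensity`) and converges almost surely.

The crux is that, for `u ≠ v`, the difference of the two martingales has an almost surely nonzero
limit, so that one vertex eventually beats the other strictly and ties do not matter
(`ae_eventually_lt_or`). If two children of `v` and one child of `u` carry subtrees of linear size,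
attaching below one or another changes the difference by clearly different amounts
(`le_sum_sq_rowDiff`), so the conditional variance collected between times `n` and `2n` is of order
`1 / n`. All later increments together also have variance of order at most `1 / n`. Comparing
conditional second and fourth moments, in the style of Paley and Zygmund, bounds the conditional
probability of a nonzero limit below by a constant, and Lévy's zero-one law turns this into
certainty (`IsAveraging.ae_limit_ne_zero`). Subtrees do have linear size by the same method applied
to a Pólya urn (`ae_exists_subtreeSize_ge`).

Finally only finitely many labels compete. A vertex with subtree size `S` has betweenness at most
`2nS`, while the root has betweenness of order `n^2`; and subtrees of large labels are uniformly
small, because pairs sharing an ancestor in `[M]` form another such martingale, of mean `2 / (M +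
1)` (`ae_exists_subtreeSize_le`). Pairwise eventual strict order on a finite set of labels then
fixes the center (`exists_eventually_centerIndex_eq`). -/

/-- Every vertex `m + 1` is attached to an earlier vertex. -/
def IsAttachment (a : ℕ → ℕ) : Prop := ∀ m, 1 ≤ m → 1 ≤ a m ∧ a m ≤ m

/-- The nearest ancestor of `t` whose label is at most `M`. -/
def anc (a : ℕ → ℕ) (M t : ℕ) : ℕ :=
  -- The guard `a (t - 1) < t` only serves termination for arbitrary `a`; for an attachment sequence
  -- and `M ≥ 1` it follows from `M < t`.
  if _h : M < t ∧ a (t - 1) < t then anc a M (a (t - 1)) else t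
termination_by t
decreasing_by exact _h.2

/-- The label of the component of `t` in the tree with `v` removed: the child of `v` it contains,
and `0` for the component of the root. -/
def branch (a : ℕ → ℕ) (v t : ℕ) : ℕ :=
  if _h : v < t ∧ a (t - 1) < t then
    if a (t - 1) = v then t else branch a v (a (t - 1))
  -- The vertex `v` itself also receives the value `0`, which is why `SameBranch` excludes `v`
  -- explicitly.
  else 0
termination_by t
decreasing_by exact _h.2

/-- The number of descendants of `w` (itself included) among the first `n` vertices. -/
def subtreeSize (a : ℕ → ℕ) (w n : ℕ) : ℕ := #{t ∈ Icc 1 n | anc a w t = w}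

/-- `s` and `t` lie in the same component of the tree with `v` removed. -/
def SameBranch (a : ℕ → ℕ) (v s t : ℕ) : Prop := s ≠ v ∧ t ≠ v ∧ branch a v s = branch a v t

/-- `s` and `t` descend from the same vertex of `[M]`. -/
def SameAnc (a : ℕ → ℕ) (M s t : ℕ) : Prop := anc a M s = anc a M t

open Classical in
/-- The number of elements of `[n]` related to `i`. -/
noncomputable def row (E : ℕ → ℕ → Prop) (n i : ℕ) : ℕ := #{t ∈ Icc 1 n | E i t}

/-- The number of related pairs in `[n]`. -/
noncomputable def pairCount (E : ℕ → ℕ → Prop) (n : ℕ) : ℕ := ∑ i ∈ Icc 1 n, row E n i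

theorem anc_of_le {a : ℕ → ℕ} {M t : ℕ} (h : t ≤ M) : anc a M t = t := by
  rw [anc, dif_neg (by omega)]

theorem anc_succ {a : ℕ → ℕ} {M t : ℕ} (h : M ≤ t) (ht : a t ≤ t) :
    anc a M (t + 1) = anc a M (a t) := by
  rw [anc, dif_pos (by simp; omega)]; simp

theorem branch_of_le {a : ℕ → ℕ} {v t : ℕ} (h : t ≤ v) : branch a v t = 0 := by
  rw [branch, dif_neg (by omega)]

theorem branch_succ {a : ℕ → ℕ} {v t : ℕ} (h : v ≤ t) (ht : a t ≤ t) :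
    branch a v (t + 1) = if a t = v then t + 1 else branch a v (a t) := by
  rw [branch, dif_pos (by simp; omega)]; simp

/-- Strong induction along the attachment sequence. -/
theorem IsAttachment.induction {a : ℕ → ℕ} (ha : IsAttachment a) {M : ℕ} (hM : 1 ≤ M)
    {P : ℕ → Prop} (base : ∀ t, 1 ≤ t → t ≤ M → P t)
    (step : ∀ t, M ≤ t → 1 ≤ a t → a t ≤ t → P (a t) → P (t + 1)) : ∀ t, 1 ≤ t → P t := by
  intro t
  induction t using Nat.strong_induction_on with
  | _ t ih =>
    intro ht
    by_cases h : t ≤ M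
    · exact base t ht h
    · obtain ⟨s, rfl⟩ : ∃ s, t = s + 1 := ⟨t - 1, by omega⟩
      obtain ⟨h1, h2⟩ := ha s (by omega)
      exact step s (by omega) h1 h2 (ih _ (by omega) h1)

theorem anc_le_self {a : ℕ → ℕ} (ha : IsAttachment a) {M : ℕ} (hM : 1 ≤ M) :
    ∀ t, 1 ≤ t → anc a M t ≤ t :=
  ha.induction hM (fun t _ h => by rw [anc_of_le h])
    fun t h _ h2 ih => by rw [anc_succ h h2]; omega

theorem branch_le {a : ℕ → ℕ} (ha : IsAttachment a) {v : ℕ} (hv : 1 ≤ v) :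
    ∀ t, 1 ≤ t → branch a v t ≤ t :=
  ha.induction hv (fun t _ h => by rw [branch_of_le h]; omega)
    fun t h _ h2 ih => by rw [branch_succ h h2]; split_ifs <;> omega

/-- Descendants of `w > M` have the same ancestor in `[M]` as `w`. -/
theorem anc_eq_of_desc {a : ℕ → ℕ} (ha : IsAttachment a) {M w : ℕ} (hM : 1 ≤ M) (h : M ≤ w) :
    ∀ t, 1 ≤ t → anc a w t = w → anc a M t = anc a M w :=
  ha.induction (hM.trans h) (fun t _ h e => by rw [anc_of_le h] at e; rw [e])
    fun t h1 _ h2 ih e => by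
      rw [anc_succ h1 h2] at e; rw [anc_succ (h.trans h1) h2]; exact ih e

theorem le_of_desc {a : ℕ → ℕ} (ha : IsAttachment a) {w : ℕ} (hw : 1 ≤ w) {t : ℕ} (ht : 1 ≤ t)
    (h : anc a w t = w) : w ≤ t := h ▸ anc_le_self ha hw t ht

/-- The way up from a descendant of `w` to `w` only meets labels at least `w > u`, so it never
crosses `u`. -/
theorem branch_eq_of_desc {a : ℕ → ℕ} (ha : IsAttachment a) {u w : ℕ} (hu : 1 ≤ u) (h : u < w) :
    ∀ t, 1 ≤ t → anc a w t = w → branch a u t = branch a u w :=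
  ha.induction (hu.trans h.le) (fun t _ h e => by rw [anc_of_le h] at e; rw [e])
    fun t h1 h3 h2 ih e => by
      rw [anc_succ h1 h2] at e
      have := le_of_desc ha (hu.trans h.le) h3 e
      rw [branch_succ (h.le.trans h1) h2, if_neg (by omega), ih e]

/-- A vertex outside the subtree of `w` lies on the side of the root. -/
theorem branch_eq_zero {a : ℕ → ℕ} (ha : IsAttachment a) {w : ℕ} (hw : 1 ≤ w) :
    ∀ t, 1 ≤ t → anc a w t ≠ w → branch a w t = 0 :=
  ha.induction hw (fun t _ h _ => branch_of_le h)
    fun t h1 h3 h2 ih e => by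
      rw [anc_succ h1 h2] at e
      rw [branch_succ h1 h2, if_neg, ih e]
      rintro h; rw [h, anc_of_le le_rfl] at e; exact e rfl

/-- The branch of a child `w + 1` of `v` consists of its descendants. -/
theorem branch_eq_child_iff {a : ℕ → ℕ} (ha : IsAttachment a) {v w : ℕ} (hv : 1 ≤ v) (h : v ≤ w)
    (hw : a w = v) : ∀ t, 1 ≤ t → (branch a v t = w + 1 ↔ anc a (w + 1) t = w + 1) := by
  refine ha.induction (M := w + 1) (by omega) (fun t h1 ht => ?_) fun t h1 h3 h2 ih => ?_
  · rw [anc_of_le ht]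
    constructor
    · intro e; have := branch_le ha hv t h1; omega
    · rintro rfl; rw [branch_succ h (by omega), if_pos hw]
  · rw [anc_succ h1 h2, branch_succ (by omega) h2]
    split_ifs with h4
    · rw [h4, anc_of_le (by omega)]; omega
    · exact ih

theorem branch_child {a : ℕ → ℕ} {u v w : ℕ} (hw : a w = v) (hu : u ≤ w) (hv : v ≤ w)
    (huv : u ≠ v) : branch a u (w + 1) = branch a u v := by
  subst hw
  rw [branch_succ hu hv, if_neg huv.symm]

/-! ### Locality -/

/-- The tree on `[n]` is determined by `a 1, …, a (n - 1)`. Dependence on these choices alone is the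
source of all later measurability with respect to `history`. -/
theorem anc_congr {a b : ℕ → ℕ} {n M : ℕ} (hM : 1 ≤ M) (hab : ∀ k, 1 ≤ k → k < n → a k = b k) :
    ∀ t, t ≤ n → anc a M t = anc b M t := by
  intro t
  induction t using Nat.strong_induction_on with
  | _ t ih =>
    intro ht
    rw [anc, anc.eq_def b]
    by_cases h : M < t
    · have := hab (t - 1) (by omega) (by omega)
      rw [← this]
      split_ifs with h'
      · exact ih _ h'.2 (by omega)
      · rfl
    · simp [h]

theorem branch_congr {a b : ℕ → ℕ} {n v : ℕ} (hv : 1 ≤ v)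
    (hab : ∀ k, 1 ≤ k → k < n → a k = b k) :
    ∀ t, t ≤ n → branch a v t = branch b v t := by
  intro t
  induction t using Nat.strong_induction_on with
  | _ t ih =>
    intro ht
    rw [branch, branch.eq_def b]
    by_cases h : v < t
    · have := hab (t - 1) (by omega) (by omega)
      rw [← this]
      split_ifs with h'
      · rfl
      · exact ih _ (by omega) (by omega)
      · rfl
    · simp [h]

theorem subtreeSize_congr {a b : ℕ → ℕ} {n w : ℕ} (hw : 1 ≤ w)
    (hab : ∀ k, 1 ≤ k → k < n → a k = b k) : subtreeSize a w n = subtreeSize b w n := by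
  unfold subtreeSize
  congr 1
  refine filter_congr fun t ht => ?_
  rw [anc_congr hw hab t (mem_Icc.1 ht).2]

theorem row_congr {E E' : ℕ → ℕ → Prop} {n i j : ℕ} (h : ∀ t ∈ Icc 1 n, (E i t ↔ E' j t)) :
    row E n i = row E' n j := by
  classical
  unfold row
  congr 1
  exact filter_congr h

theorem pairCount_congr {E E' : ℕ → ℕ → Prop} {n : ℕ}
    (h : ∀ i ∈ Icc 1 n, ∀ t ∈ Icc 1 n, (E i t ↔ E' i t)) : pairCount E n = pairCount E' n :=
  sum_congr rfl fun i hi => row_congr (h i hi)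

theorem sameBranch_congr {a b : ℕ → ℕ} {n v : ℕ} (hv : 1 ≤ v)
    (hab : ∀ k, 1 ≤ k → k < n → a k = b k) :
    ∀ i ∈ Icc 1 n, ∀ t ∈ Icc 1 n, (SameBranch a v i t ↔ SameBranch b v i t) := by
  intro i hi t ht
  simp only [SameBranch, branch_congr hv hab i (mem_Icc.1 hi).2,
    branch_congr hv hab t (mem_Icc.1 ht).2]

theorem sameAnc_congr {a b : ℕ → ℕ} {n v : ℕ} (hv : 1 ≤ v)
    (hab : ∀ k, 1 ≤ k → k < n → a k = b k) :
    ∀ i ∈ Icc 1 n, ∀ t ∈ Icc 1 n, (SameAnc a v i t ↔ SameAnc b v i t) := by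
  intro i hi t ht
  simp only [SameAnc, anc_congr hv hab i (mem_Icc.1 hi).2, anc_congr hv hab t (mem_Icc.1 ht).2]

/-! ### Counting -/

theorem row_le (E : ℕ → ℕ → Prop) (n i : ℕ) : row E n i ≤ n := by
  classical
  unfold row
  refine (card_filter_le _ _).trans ?_
  simp

theorem pairCount_le (E : ℕ → ℕ → Prop) (n : ℕ) : pairCount E n ≤ n * n := by
  unfold pairCount
  refine (sum_le_card_nsmul _ _ n fun i _ => row_le E n i).trans ?_
  simp

theorem row_succ {E : ℕ → ℕ → Prop} {n i : ℕ} [Decidable (E i (n + 1))] :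
    row E (n + 1) i = row E n i + if E i (n + 1) then 1 else 0 := by
  classical
  unfold row
  rw [← insert_Icc_right_eq_Icc_add_one (by omega), filter_insert]
  split_ifs with h
  · rw [card_insert_of_notMem (by simp)]
  · rfl

/-- By `hcopy` the new vertex has the row of its parent; symmetry counts this row twice, and the
diagonal pair contributes the last `1`. -/
theorem pairCount_succ {a : ℕ → ℕ} {E : ℕ → ℕ → Prop} {n : ℕ} (hsymm : ∀ s t, E s t → E t s)
    (hself : E (n + 1) (n + 1)) (hcopy : ∀ t ∈ Icc 1 n, (E (n + 1) t ↔ E (a n) t)) :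
    pairCount E (n + 1) = pairCount E n + 2 * row E n (a n) + 1 := by
  classical
  have h1 : row E n (n + 1) = row E n (a n) := by
    unfold row
    congr 1
    exact filter_congr hcopy
  have h2 : ∑ i ∈ Icc 1 n, (if E i (n + 1) then 1 else 0) = row E n (a n) := by
    rw [← h1, row, card_filter]
    refine sum_congr rfl fun i _ => ?_
    congr 1
    exact propext ⟨hsymm _ _, hsymm _ _⟩
  unfold pairCount
  rw [← insert_Icc_right_eq_Icc_add_one (by omega), sum_insert (by simp)]
  simp only [row_succ, sum_add_distrib, h1, h2, if_pos hself]
  ring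

theorem pairCount_sameBranch_succ {a : ℕ → ℕ} (ha : IsAttachment a) {v n : ℕ} (hv : 1 ≤ v)
    (hn : v ≤ n) : pairCount (SameBranch a v) (n + 1) =
      pairCount (SameBranch a v) n + 2 * row (SameBranch a v) n (a n) + 1 := by
  refine pairCount_succ (fun s t h => ⟨h.2.1, h.1, h.2.2.symm⟩) ⟨by omega, by omega, rfl⟩
    fun t ht => ?_
  obtain ⟨h1, h2⟩ := mem_Icc.1 ht
  have h3 := branch_le ha hv t h1
  simp only [SameBranch, branch_succ hn (ha n (by omega)).2]
  -- If the parent is `v`, the new vertex is a component of its own and `v` is related to nothing,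
  -- so both rows are empty on `[n]`.
  split_ifs with h
  · constructor <;> intro h' <;> omega
  · constructor <;> intro h' <;> exact ⟨by omega, h'.2⟩

theorem pairCount_sameAnc_succ {a : ℕ → ℕ} (ha : IsAttachment a) {v n : ℕ} (hv : 1 ≤ v)
    (hn : v ≤ n) : pairCount (SameAnc a v) (n + 1) =
      pairCount (SameAnc a v) n + 2 * row (SameAnc a v) n (a n) + 1 := by
  refine pairCount_succ (fun s t h => h.symm) rfl fun t ht => ?_
  simp only [SameAnc, anc_succ hn (ha n (by omega)).2]

theorem subtreeSize_succ {a : ℕ → ℕ} (ha : IsAttachment a) {w n : ℕ} (hw : 1 ≤ w) (hn : w ≤ n) :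
    subtreeSize a w (n + 1) = subtreeSize a w n + if anc a w (a n) = w then 1 else 0 := by
  unfold subtreeSize
  rw [← insert_Icc_right_eq_Icc_add_one (by omega), filter_insert,
    anc_succ hn (ha n (by omega)).2]
  split_ifs with h
  · rw [card_insert_of_notMem (by simp)]
  · rfl

theorem subtreeSize_le (a : ℕ → ℕ) (w n : ℕ) : subtreeSize a w n ≤ n := by
  unfold subtreeSize
  refine (card_filter_le _ _).trans ?_
  simp

theorem subtreeSize_mono (a : ℕ → ℕ) (w : ℕ) : Monotone (subtreeSize a w) := fun m n h => by
  unfold subtreeSize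
  refine card_le_card fun t ht => ?_
  simp only [mem_filter, mem_Icc] at ht ⊢
  exact ⟨⟨ht.1.1, ht.1.2.trans h⟩, ht.2⟩

theorem subtreeSize_pos (a : ℕ → ℕ) {w n : ℕ} (hw : 1 ≤ w) (hn : w ≤ n) :
    1 ≤ subtreeSize a w n :=
  card_pos.2 ⟨w, by simp [anc_of_le, hw, hn]⟩

/-- The descendants of `w` share one ancestor in `[M]`, hence are pairwise related. -/
theorem subtreeSize_sq_le {a : ℕ → ℕ} (ha : IsAttachment a) {M w n : ℕ} (hM : 1 ≤ M)
    (h : M ≤ w) : subtreeSize a w n * subtreeSize a w n ≤ pairCount (SameAnc a M) n := by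
  classical
  unfold pairCount
  calc _ = ∑ i ∈ Icc 1 n with anc a w i = w, subtreeSize a w n := by simp [subtreeSize]
    _ ≤ ∑ i ∈ Icc 1 n with anc a w i = w, row (SameAnc a M) n i := by
        refine sum_le_sum fun i hi => ?_
        unfold row subtreeSize
        refine card_le_card fun t ht => ?_
        simp only [mem_filter, mem_Icc] at hi ht ⊢
        exact ⟨ht.1, (anc_eq_of_desc ha hM h i hi.1.1 hi.2).trans
          (anc_eq_of_desc ha hM h t ht.1.1 ht.2).symm⟩
    _ ≤ _ := sum_le_sum_of_subset (filter_subset _ _)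

theorem pairCount_sameAnc_self (a : ℕ → ℕ) (M : ℕ) : pairCount (SameAnc a M) M = M := by
  classical
  unfold pairCount
  rw [sum_congr rfl (g := fun _ => 1)]
  · simp
  · intro i hi
    unfold row
    rw [card_eq_one]
    refine ⟨i, ?_⟩
    ext t
    rw [mem_filter, mem_singleton, mem_Icc]
    rw [mem_Icc] at hi
    constructor
    · rintro ⟨h1, h2⟩
      rw [SameAnc] at h2
      rw [anc_of_le hi.2, anc_of_le h1.2] at h2
      exact h2.symm
    · rintro rfl; exact ⟨hi, rfl⟩

theorem row_sameBranch_eq_subtreeSize {a : ℕ → ℕ} (ha : IsAttachment a) {v w i n : ℕ}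
    (hv : 1 ≤ v) (h : v ≤ w) (hw : a w = v) (hi : 1 ≤ i) (hd : anc a (w + 1) i = w + 1) :
    row (SameBranch a v) n i = subtreeSize a (w + 1) n := by
  classical
  unfold row subtreeSize
  congr 1
  refine filter_congr fun t ht => ?_
  obtain ⟨h1, h2⟩ := mem_Icc.1 ht
  rw [← branch_eq_child_iff ha hv h hw t h1, SameBranch,
    (branch_eq_child_iff ha hv h hw i hi).2 hd]
  constructor
  · rintro ⟨-, -, h⟩; exact h.symm
  · intro e
    refine ⟨?_, ?_, e.symm⟩
    · have := le_of_desc ha (by omega) hi hd; omega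
    · rintro rfl; rw [branch_of_le le_rfl] at e; omega

/-- Descendants of distinct children of `v` are counted separately. -/
theorem add_le_row_sameBranch {a : ℕ → ℕ} (ha : IsAttachment a) {u v w₁ w₂ n : ℕ}
    (hu : 1 ≤ u) (huv : u < v) (h₁ : v ≤ w₁) (h₂ : v ≤ w₂) (hw₁ : a w₁ = v) (hw₂ : a w₂ = v)
    (hne : w₁ ≠ w₂) :
    subtreeSize a (w₁ + 1) n + subtreeSize a (w₂ + 1) n ≤ row (SameBranch a u) n v := by
  classical
  unfold row subtreeSize
  rw [← card_union_of_disjoint]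
  · refine card_le_card fun t ht => ?_
    simp only [mem_union, mem_filter, mem_Icc] at ht ⊢
    have key : ∀ w, v ≤ w → a w = v → 1 ≤ t → anc a (w + 1) t = w + 1 → SameBranch a u v t := by
      intro w h hw h1 hd
      refine ⟨by omega, ?_, ?_⟩
      · have := le_of_desc ha (by omega) h1 hd; omega
      · rw [branch_eq_of_desc ha hu (by omega) t h1 hd, branch_child hw (by omega) h (by omega)]
    rcases ht with ⟨h, hd⟩ | ⟨h, hd⟩
    · exact ⟨h, key _ h₁ hw₁ h.1 hd⟩
    · exact ⟨h, key _ h₂ hw₂ h.1 hd⟩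
  · rw [disjoint_left]
    intro t ht ht'
    simp only [mem_filter, mem_Icc] at ht ht'
    have e₁ := (branch_eq_child_iff ha (by omega) h₁ hw₁ t ht.1.1).2 ht.2
    have e₂ := (branch_eq_child_iff ha (by omega) h₂ hw₂ t ht.1.1).2 ht'.2
    omega

/-- Descendants of `j + 1 > v` are reached from `u` through labels greater than `v`, so removing `v`
does not cut them off from `u`. -/
theorem subtreeSize_le_row_sameBranch {a : ℕ → ℕ} (ha : IsAttachment a) {u v j n : ℕ}
    (hu : 1 ≤ u) (huv : u < v) (hj : v ≤ j) (haj : a j = u) :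
    subtreeSize a (j + 1) n ≤ row (SameBranch a v) n u := by
  classical
  unfold row subtreeSize
  refine card_le_card fun t ht => ?_
  simp only [mem_filter, mem_Icc] at ht ⊢
  refine ⟨ht.1, by omega, ?_, ?_⟩
  · have := le_of_desc ha (by omega) ht.1.1 ht.2; omega
  · rw [branch_eq_of_desc ha (by omega) (by omega) t ht.1.1 ht.2,
      branch_child haj hj (by omega) (by omega)]

theorem row_sameBranch_eq_of_branch_eq {a : ℕ → ℕ} {v i j n : ℕ} (hi : i ≠ v) (hj : j ≠ v)
    (h : branch a v i = branch a v j) : row (SameBranch a v) n i = row (SameBranch a v) n j :=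
  row_congr fun t _ => by simp [SameBranch, hi, hj, h]

end URRT

/-! ### Betweenness in terms of branches -/

namespace URRT

open Finset

theorem tree_adj {a : ℕ → ℕ} {n : ℕ} {x y : Vertex n} : (tree a n).Adj x y ↔ x ≠ y ∧
    ((∃ m : ℕ, 1 ≤ m ∧ (x : ℕ) = a m ∧ (y : ℕ) = m + 1) ∨
      ∃ m : ℕ, 1 ≤ m ∧ (y : ℕ) = a m ∧ (x : ℕ) = m + 1) := by
  rw [tree, SimpleGraph.fromRel_adj]

theorem branch_eq_of_adj {a : ℕ → ℕ} (ha : IsAttachment a) {n v : ℕ} {x y : Vertex n}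
    (h : (tree a n).Adj x y) (hx : (x : ℕ) ≠ v) (hy : (y : ℕ) ≠ v) :
    branch a v x = branch a v y := by
  have key : ∀ m : ℕ, 1 ≤ m → a m ≠ v → m + 1 ≠ v →
      branch a v (a m) = branch a v (m + 1) := by
    intro m hm h1 h2
    have := ha m hm
    by_cases h3 : v ≤ m
    · rw [branch_succ h3 this.2, if_neg h1]
    · rw [branch_of_le (by omega), branch_of_le (by omega)]
  rcases (tree_adj.1 h).2 with ⟨m, hm, e1, e2⟩ | ⟨m, hm, e1, e2⟩
  · rw [e1, e2]; exact key m hm (e1 ▸ hx) (e2 ▸ hy)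
  · rw [e1, e2]; exact (key m hm (e1 ▸ hy) (e2 ▸ hx)).symm

/-- The neighbours of `v` are its parent and its children, and their branch labels tell them apart.
-/
theorem branch_of_adj {a : ℕ → ℕ} (ha : IsAttachment a) {n : ℕ} {v x : Vertex n}
    (h : (tree a n).Adj v x) : ((x : ℕ) = a (v - 1) ∧ branch a v x = 0) ∨
      ((v : ℕ) < x ∧ branch a v x = x) := by
  rcases (tree_adj.1 h).2 with ⟨m, hm, e1, e2⟩ | ⟨m, hm, e1, e2⟩
  · have := ha m hm
    right
    rw [e2, branch_succ (by omega) this.2, if_pos e1.symm]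
    omega
  · have := ha m hm
    left
    rw [branch_of_le (by omega), e2, e1]
    simp

theorem branch_ne_of_adj {a : ℕ → ℕ} (ha : IsAttachment a) {n : ℕ} {v x y : Vertex n}
    (hx : (tree a n).Adj v x) (hy : (tree a n).Adj v y) (hxy : x ≠ y) :
    branch a v x ≠ branch a v y := by
  have hxy' : (x : ℕ) ≠ y := fun h => hxy (Subtype.ext h)
  rcases branch_of_adj ha hx with h1 | h1 <;> rcases branch_of_adj ha hy with h2 | h2 <;> omega

theorem branch_eq_of_walk {a : ℕ → ℕ} (ha : IsAttachment a) {n : ℕ} {v s t : Vertex n}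
    (p : (tree a n).Walk s t) (hp : v ∉ p.support) : branch a v s = branch a v t := by
  induction p with
  | nil => rfl
  | @cons x y z h q ih =>
    rw [SimpleGraph.Walk.support_cons, List.mem_cons, not_or] at hp
    rw [← ih hp.2]
    refine branch_eq_of_adj ha h (fun e => hp.1 (Subtype.ext e).symm) fun e => hp.2 ?_
    rw [← Subtype.ext e]; exact q.start_mem_support

theorem exists_adj_of_isPath {a : ℕ → ℕ} (ha : IsAttachment a) {n : ℕ} {v t : Vertex n}
    (p : (tree a n).Walk v t) (hp : p.IsPath) (ht : t ≠ v) :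
    ∃ y, (tree a n).Adj v y ∧ y ∈ p.support.tail ∧ branch a v y = branch a v t := by
  cases p with
  | nil => exact absurd rfl ht
  | @cons _ y _ h q =>
    rw [SimpleGraph.Walk.cons_isPath_iff] at hp
    exact ⟨y, h, by simp, branch_eq_of_walk ha q hp.2⟩

theorem tree_reachable {a : ℕ → ℕ} (ha : IsAttachment a) {n : ℕ} (h1 : 1 ∈ Icc 1 n) :
    ∀ t, 1 ≤ t → ∀ ht : t ∈ Icc 1 n, (tree a n).Reachable ⟨1, h1⟩ ⟨t, ht⟩ := by
  refine ha.induction le_rfl (fun t h h' ht => ?_) fun t h h3 h2 ih ht => ?_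
  · obtain rfl : t = 1 := by omega
    exact SimpleGraph.Reachable.refl _
  · have hm := mem_Icc.1 ht
    have ht' : a t ∈ Icc 1 n := mem_Icc.2 ⟨h3, by omega⟩
    refine (ih ht').trans (SimpleGraph.Adj.reachable (tree_adj.2 ⟨?_, Or.inl ⟨t, h, rfl, rfl⟩⟩))
    intro e
    have := congrArg Subtype.val e
    simp only at this
    omega

/-- On a path through `v` the neighbours just before and just after `v` are distinct, hence lie in
distinct branches; conversely the branch is constant along a walk avoiding `v`. Uniqueness of paths
is not needed. -/
theorem exists_path_through_iff {a : ℕ → ℕ} (ha : IsAttachment a) {n : ℕ} {v s t : Vertex n}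
    (hs : s ≠ v) (ht : t ≠ v) :
    (∃ p : (tree a n).Walk s t, p.IsPath ∧ v ∈ p.support) ↔ branch a v s ≠ branch a v t := by
  classical
  constructor
  · rintro ⟨p, hp, hv⟩
    obtain ⟨y, hy, hy', ey⟩ := exists_adj_of_isPath ha (p.dropUntil v hv) (hp.dropUntil hv) ht
    obtain ⟨x, hx, hx', ex⟩ := exists_adj_of_isPath ha (p.takeUntil v hv).reverse
      (hp.takeUntil hv).reverse hs
    rw [← ey, ← ex]
    refine branch_ne_of_adj ha hx hy ?_
    -- A common neighbour would occur on the path both before and after `v`.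
    rintro rfl
    have h1 : x ∈ (p.takeUntil v hv).support := by
      have := List.mem_of_mem_tail hx'
      rwa [SimpleGraph.Walk.support_reverse, List.mem_reverse] at this
    have h2 := hp.support_nodup
    rw [← p.take_spec hv, SimpleGraph.Walk.support_append, List.nodup_append] at h2
    exact h2.2.2 x h1 x hy' rfl
  · intro h
    have h1 : 1 ∈ Icc 1 n := mem_Icc.2 ⟨le_rfl, (mem_Icc.1 s.2).1.trans (mem_Icc.1 s.2).2⟩
    have hr : (tree a n).Reachable s t :=
      (tree_reachable ha h1 s (mem_Icc.1 s.2).1 s.2).symm.trans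
        (tree_reachable ha h1 t (mem_Icc.1 t.2).1 t.2)
    obtain ⟨p⟩ := hr
    refine ⟨p.bypass, p.bypass_isPath, ?_⟩
    by_contra hv
    exact h (branch_eq_of_walk ha _ hv)

theorem betweenness_eq_card {a : ℕ → ℕ} (ha : IsAttachment a) {n : ℕ} (v : Vertex n) :
    betweenness (tree a n) v = #{st ∈ Icc 1 n ×ˢ Icc 1 n |
      st.1 ≠ (v : ℕ) ∧ st.2 ≠ (v : ℕ) ∧ branch a v st.1 ≠ branch a v st.2} := by
  classical
  rw [betweenness, ← Set.ncard_coe_finset]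
  refine Set.ncard_congr (fun st _ => ((st.1 : ℕ), (st.2 : ℕ))) ?_ ?_ ?_
  · rintro ⟨s, t⟩ ⟨hs, ht, h⟩
    simp only at hs ht h
    rw [exists_path_through_iff ha hs ht] at h
    rw [mem_coe, mem_filter, mem_product]
    exact ⟨⟨s.2, t.2⟩, fun e => hs (Subtype.ext e), fun e => ht (Subtype.ext e), h⟩
  · rintro ⟨s, t⟩ ⟨s', t'⟩ _ _ h
    rw [Prod.mk.injEq] at h
    exact Prod.ext (Subtype.ext h.1) (Subtype.ext h.2)
  · rintro ⟨s, t⟩ h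
    rw [mem_coe, mem_filter, mem_product] at h
    obtain ⟨⟨h1, h2⟩, h3, h4, h5⟩ := h
    have hs : (⟨s, h1⟩ : Vertex n) ≠ v := fun e => h3 (congrArg Subtype.val e)
    have ht : (⟨t, h2⟩ : Vertex n) ≠ v := fun e => h4 (congrArg Subtype.val e)
    exact ⟨(⟨s, h1⟩, ⟨t, h2⟩), ⟨hs, ht, (exists_path_through_iff ha hs ht).2 h5⟩, rfl⟩

theorem pairCount_eq_card (E : ℕ → ℕ → Prop) [DecidablePred fun st : ℕ × ℕ => E st.1 st.2]
    (n : ℕ) : pairCount E n = #{st ∈ Icc 1 n ×ˢ Icc 1 n | E st.1 st.2} := by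
  classical
  rw [card_filter, sum_product]
  unfold pairCount row
  refine sum_congr rfl fun i _ => ?_
  rw [card_filter]
  exact sum_congr rfl fun j _ => by congr

/-- Pairs avoiding `v` are either separated by `v` or in one branch. The diagonal pairs fall in the
second class, so the total is the full square. -/
theorem betweenness_add_pairCount {a : ℕ → ℕ} (ha : IsAttachment a) {n : ℕ} (v : Vertex n) :
    betweenness (tree a n) v + pairCount (SameBranch a v) n = (n - 1) * (n - 1) := by
  classical
  rw [betweenness_eq_card ha, pairCount_eq_card, ← card_union_of_disjoint]
  · have h : #((Icc 1 n).erase (v : ℕ)) = n - 1 := by simp [card_erase_of_mem v.2]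
    rw [← h, ← card_product]
    congr 1
    ext ⟨s, t⟩
    simp only [mem_union, mem_filter, mem_product, mem_erase]
    unfold SameBranch
    tauto
  · rw [disjoint_left]
    rintro ⟨s, t⟩ h h'
    rw [mem_filter] at h h'
    exact h.2.2.2 h'.2.2.2

/-- Everything outside the subtree of `v` lies in the root's component, so a separated pair has an
endpoint in that subtree. -/
theorem betweenness_le {a : ℕ → ℕ} (ha : IsAttachment a) {n : ℕ} (v : Vertex n) :
    betweenness (tree a n) v ≤ 2 * n * subtreeSize a v n := by
  classical
  have hv := (mem_Icc.1 v.2).1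
  set D := {t ∈ Icc 1 n | anc a v t = v} with hD
  calc _ ≤ #(D ×ˢ Icc 1 n ∪ Icc 1 n ×ˢ D) := by
        rw [betweenness_eq_card ha]
        refine card_le_card ?_
        rintro ⟨s, t⟩ h
        simp only [mem_filter, mem_product, mem_union, hD] at h ⊢
        by_contra hc
        have h1 := branch_eq_zero ha hv s (mem_Icc.1 h.1.1).1 (by tauto)
        have h2 := branch_eq_zero ha hv t (mem_Icc.1 h.1.2).1 (by tauto)
        exact h.2.2.2 (h1.trans h2.symm)
    _ ≤ _ := card_union_le _ _
    _ = _ := by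
        have : #D = subtreeSize a v n := rfl
        rw [card_product, card_product, this]; simp; ring

theorem le_betweenness_one {a : ℕ → ℕ} (ha : IsAttachment a) {n w₁ w₂ : ℕ} (h1 : 1 ∈ Icc 1 n)
    (h₁ : 1 ≤ w₁) (h₂ : 1 ≤ w₂) (hw₁ : a w₁ = 1) (hw₂ : a w₂ = 1) (hne : w₁ ≠ w₂) :
    subtreeSize a (w₁ + 1) n * subtreeSize a (w₂ + 1) n ≤ betweenness (tree a n) ⟨1, h1⟩ := by
  classical
  rw [betweenness_eq_card ha, subtreeSize, subtreeSize, ← card_product]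
  refine card_le_card ?_
  rintro ⟨s, t⟩ h
  simp only [mem_filter, mem_product] at h ⊢
  obtain ⟨⟨hs, hs'⟩, ht, ht'⟩ := h
  have h3 := (mem_Icc.1 hs).1
  have h4 := (mem_Icc.1 ht).1
  have e₁ := (branch_eq_child_iff ha le_rfl h₁ hw₁ s h3).2 hs'
  have e₂ := (branch_eq_child_iff ha le_rfl h₂ hw₂ t h4).2 ht'
  have := le_of_desc ha (by omega) h3 hs'
  have := le_of_desc ha (by omega) h4 ht'
  exact ⟨⟨hs, ht⟩, by omega, by omega, by omega⟩

/-! ### Spread of the increments -/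

/-- The change of the difference of pair counts for `v` and `u` caused by attaching to `i`. -/
noncomputable def rowDiff (a : ℕ → ℕ) (u v n i : ℕ) : ℝ :=
  (row (SameBranch a v) n i : ℝ) - row (SameBranch a u) n i

theorem half_mul_sq_sub_le {x y z : ℝ} : (y - x) ^ 2 / 2 ≤ (x - z) ^ 2 + (y - z) ^ 2 := by
  nlinarith [sq_nonneg (x + y - 2 * z)]

/-- The increments are spread out when the relevant subtrees are large. -/
theorem le_sum_sq_rowDiff {a : ℕ → ℕ} (ha : IsAttachment a) {u v w₁ w₂ j n : ℕ} {r z : ℝ}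
    (hr : 0 ≤ r)
    (hu : 1 ≤ u) (huv : u < v) (h₁ : v ≤ w₁) (h₂ : v ≤ w₂) (hj : v ≤ j) (hw₁ : a w₁ = v)
    (hw₂ : a w₂ = v) (haj : a j = u) (hne : w₁ ≠ w₂) (hS₁ : r ≤ subtreeSize a (w₁ + 1) n)
    (hS₂ : r ≤ subtreeSize a (w₂ + 1) n) (hSj : r ≤ subtreeSize a (j + 1) n) :
    r ^ 3 / 2 ≤ ∑ i ∈ Icc 1 n, (rowDiff a u v n i - z) ^ 2 := by
  classical
  obtain ⟨C, eC⟩ : ∃ C : ℝ, C = row (SameBranch a u) n v := ⟨_, rfl⟩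
  obtain ⟨C', eC'⟩ : ∃ C : ℝ, C = row (SameBranch a v) n u := ⟨_, rfl⟩
  obtain ⟨α, hα⟩ : ∃ α : ℝ, α = subtreeSize a (w₁ + 1) n - C := ⟨_, rfl⟩
  obtain ⟨β, hβ⟩ : ∃ β : ℝ, β = C' - subtreeSize a (j + 1) n := ⟨_, rfl⟩
  have hC : (subtreeSize a (w₁ + 1) n : ℝ) + subtreeSize a (w₂ + 1) n ≤ C := by
    rw [eC]; exact_mod_cast add_le_row_sameBranch ha hu huv h₁ h₂ hw₁ hw₂ hne
  have hC' : (subtreeSize a (j + 1) n : ℝ) ≤ C' := by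
    rw [eC']; exact_mod_cast subtreeSize_le_row_sameBranch ha hu huv hj haj
  -- The increment is `α` below `w₁ + 1` and `β` below `j + 1`. The second child of `v` forces `α ≤
  -- -r`, since the component `C` contains both subtrees, while `β ≥ 0`.
  have hgap : r ≤ β - α := by linarith
  obtain ⟨W, eW⟩ : ∃ W, W = {t ∈ Icc 1 n | anc a (w₁ + 1) t = w₁ + 1} := ⟨_, rfl⟩
  obtain ⟨J, eJ⟩ : ∃ J, J = {t ∈ Icc 1 n | anc a (j + 1) t = j + 1} := ⟨_, rfl⟩
  have cW : #W = subtreeSize a (w₁ + 1) n := by rw [eW, subtreeSize]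
  have cJ : #J = subtreeSize a (j + 1) n := by rw [eJ, subtreeSize]
  have gW : ∀ i ∈ W, rowDiff a u v n i = α := by
    intro i hi
    rw [eW] at hi
    obtain ⟨hi, hd⟩ := mem_filter.1 hi
    have h1 := (mem_Icc.1 hi).1
    have := le_of_desc ha (by omega) h1 hd
    rw [hα, eC, rowDiff, row_sameBranch_eq_subtreeSize ha (by omega) h₁ hw₁ h1 hd,
      row_sameBranch_eq_of_branch_eq (j := v) (by omega) (by omega)]
    rw [branch_eq_of_desc ha hu (by omega) i h1 hd, branch_child hw₁ (by omega) h₁ (by omega)]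
  have gJ : ∀ i ∈ J, rowDiff a u v n i = β := by
    intro i hi
    rw [eJ] at hi
    obtain ⟨hi, hd⟩ := mem_filter.1 hi
    have h1 := (mem_Icc.1 hi).1
    have := le_of_desc ha (by omega) h1 hd
    rw [hβ, eC', rowDiff, row_sameBranch_eq_subtreeSize ha hu (by omega) haj h1 hd,
      row_sameBranch_eq_of_branch_eq (j := u) (by omega) (by omega)]
    rw [branch_eq_of_desc ha (by omega) (by omega) i h1 hd,
      branch_child haj hj (by omega) (by omega)]
  have hdisj : r = 0 ∨ Disjoint W J := by
    rcases hr.eq_or_lt with h | h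
    · exact Or.inl h.symm
    · right
      rw [disjoint_left]
      intro i hi hi'
      have := (gW i hi).symm.trans (gJ i hi')
      linarith
  rcases hdisj with rfl | hdisj
  · simp only [ne_eq, OfNat.ofNat_ne_zero, not_false_eq_true, zero_pow, zero_div]
    positivity
  calc r ^ 3 / 2 = r * (r ^ 2 / 2) := by ring
    _ ≤ r * ((β - α) ^ 2 / 2) := by gcongr
    _ ≤ r * ((α - z) ^ 2 + (β - z) ^ 2) := by gcongr; exact half_mul_sq_sub_le
    _ = r * (α - z) ^ 2 + r * (β - z) ^ 2 := by ring
    _ ≤ #W * (α - z) ^ 2 + #J * (β - z) ^ 2 := by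
        rw [← cW] at hS₁
        rw [← cJ] at hSj
        gcongr
    _ = ∑ i ∈ W, (rowDiff a u v n i - z) ^ 2 + ∑ i ∈ J, (rowDiff a u v n i - z) ^ 2 := by
        rw [sum_congr rfl fun i hi => by rw [gW i hi], sum_congr (s₁ := J) rfl fun i hi => by
          rw [gJ i hi]]
        simp
    _ = ∑ i ∈ W ∪ J, (rowDiff a u v n i - z) ^ 2 := (sum_union hdisj).symm
    _ ≤ _ := sum_le_sum_of_subset_of_nonneg
        (union_subset (eW ▸ filter_subset _ _) (eJ ▸ filter_subset _ _)) fun _ _ _ => sq_nonneg _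

end URRT

/-! ### Filtration of the growing tree and conditional averaging -/

namespace URRT

open Finset MeasureTheory ProbabilityTheory Filter Topology

/-- `f` is bounded and measurable with respect to `m`. -/
def BddMeas {Ω : Type*} (m : MeasurableSpace Ω) (f : Ω → ℝ) : Prop :=
  Measurable[m] f ∧ ∃ C, ∀ ω, |f ω| ≤ C

namespace BddMeas

variable {Ω : Type*} {m m' : MeasurableSpace Ω} {f g : Ω → ℝ}

theorem mono (hf : BddMeas m f) (h : m ≤ m') : BddMeas m' f := ⟨hf.1.mono h le_rfl, hf.2⟩

theorem const (c : ℝ) : BddMeas m fun _ => c := ⟨measurable_const, |c|, fun _ => le_rfl⟩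

theorem mul (hf : BddMeas m f) (hg : BddMeas m g) : BddMeas m fun ω => f ω * g ω := by
  obtain ⟨C, hC⟩ := hf.2
  obtain ⟨D, hD⟩ := hg.2
  refine ⟨hf.1.mul hg.1, C * D, fun ω => ?_⟩
  rw [abs_mul]
  exact mul_le_mul (hC ω) (hD ω) (abs_nonneg _) ((abs_nonneg _).trans (hC ω))

theorem add (hf : BddMeas m f) (hg : BddMeas m g) : BddMeas m fun ω => f ω + g ω := by
  obtain ⟨C, hC⟩ := hf.2
  obtain ⟨D, hD⟩ := hg.2
  exact ⟨hf.1.add hg.1, C + D, fun ω => (abs_add_le _ _).trans (add_le_add (hC ω) (hD ω))⟩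

theorem sub (hf : BddMeas m f) (hg : BddMeas m g) : BddMeas m fun ω => f ω - g ω := by
  simpa [sub_eq_add_neg] using hf.add ((const (-1)).mul hg)

theorem pow (hf : BddMeas m f) (k : ℕ) : BddMeas m fun ω => f ω ^ k := by
  induction k with
  | zero => simpa using const 1
  | succ k ih => simpa [pow_succ] using ih.mul hf

theorem sum {ι : Type*} {s : Finset ι} {F : ι → Ω → ℝ} (hF : ∀ i ∈ s, BddMeas m (F i)) :
    BddMeas m fun ω => ∑ i ∈ s, F i ω := by
  classical
  induction s using Finset.induction_on with
  | empty => simpa using const 0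
  | insert i s hi ih =>
    simp only [sum_insert hi]
    exact (hF i (mem_insert_self i s)).add (ih fun j hj => hF j (mem_insert_of_mem hj))

theorem indicator (hf : BddMeas m f) {s : Set Ω} (hs : MeasurableSet[m] s) :
    BddMeas m (s.indicator f) := by
  obtain ⟨C, hC⟩ := hf.2
  refine ⟨hf.1.indicator hs, C, fun ω => ?_⟩
  by_cases h : ω ∈ s
  · rw [Set.indicator_of_mem h]; exact hC ω
  · rw [Set.indicator_of_notMem h, abs_zero]; exact (abs_nonneg _).trans (hC ω)

theorem integrable [m₀ : MeasurableSpace Ω] {μ : Measure Ω} [IsFiniteMeasure μ]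
    (hf : BddMeas m f) (h : m ≤ m₀) : Integrable f μ := by
  obtain ⟨C, hC⟩ := hf.2
  exact Integrable.of_bound (hf.1.mono h le_rfl).aestronglyMeasurable C (Eventually.of_forall hC)

end BddMeas

variable {Ω : Type*} [MeasurableSpace Ω] {μ : Measure Ω} {A : ℕ → Ω → ℕ}

/-- The restriction of a sequence to the indices `1, …, n - 1`. -/
def prefixSeq (n : ℕ) (a : ℕ → ℕ) (k : Fin n) : ℕ := if (k : ℕ) = 0 then 0 else a k

theorem IsUniformAttachment.measurable_prefixSeq (hA : IsUniformAttachment μ A) (n : ℕ) :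
    Measurable fun ω => prefixSeq n fun k => A k ω := by
  refine measurable_pi_lambda _ fun k => ?_
  unfold prefixSeq
  -- `A 0` is not assumed measurable; `prefixSeq` therefore puts a constant at index `0`.
  split_ifs with h
  · exact measurable_const
  · exact hA.measurable _ (by omega)

/-- The history of the growth: the `n`-th σ-algebra is generated by the tree on `[n]`. -/
def history (hA : IsUniformAttachment μ A) : Filtration ℕ ‹MeasurableSpace Ω› where
  seq n := MeasurableSpace.comap (fun ω => prefixSeq n fun k => A k ω) inferInstance
  mono' m n h := by
    rw [← measurable_iff_comap_le]
    have : (fun ω => prefixSeq m fun k => A k ω) =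
        (fun x : Fin n → ℕ => fun k : Fin m => x (Fin.castLE h k)) ∘
          fun ω => prefixSeq n fun k => A k ω := rfl
    rw [this]
    refine Measurable.comp ?_ (comap_measurable _)
    fun_prop
  le' n := (hA.measurable_prefixSeq n).comap_le

/-- A function of the tree on `[n]` is measurable with respect to the history. -/
theorem measurable_history (hA : IsUniformAttachment μ A) {α : Type*} [MeasurableSpace α] {n : ℕ}
    {f : (ℕ → ℕ) → α} (hf : ∀ a b : ℕ → ℕ, (∀ k, 1 ≤ k → k < n → a k = b k) → f a = f b) :
    Measurable[history hA n] fun ω => f fun k => A k ω := by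
  have : (fun ω => f fun k => A k ω) =
      (fun x : Fin n → ℕ => f fun k => if h : k < n then x ⟨k, h⟩ else 0) ∘
        fun ω => prefixSeq n fun k => A k ω := by
    ext ω
    refine hf _ _ fun k hk hkn => ?_
    simp [hkn, prefixSeq, Nat.one_le_iff_ne_zero.1 hk]
  rw [this]
  exact (measurable_of_countable _).comp (comap_measurable _)

/-- The `m` values in `[m]` have mass `1 / m` each and so exhaust the probability. -/
theorem IsUniformAttachment.ae_isAttachment [IsProbabilityMeasure μ]
    (hA : IsUniformAttachment μ A) : ∀ᵐ ω ∂μ, IsAttachment fun k => A k ω := by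
  unfold IsAttachment
  rw [ae_all_iff]
  intro m
  by_cases hm : 1 ≤ m
  swap
  · exact Eventually.of_forall fun ω h => absurd h hm
  have hms : ∀ i, MeasurableSet {ω | A m ω = i} := fun i =>
    hA.measurable m hm (measurableSet_singleton i)
  have h1 : μ (⋃ i ∈ Icc 1 m, {ω | A m ω = i}) = 1 := by
    rw [measure_biUnion_finset _ fun i _ => hms i]
    · rw [sum_congr rfl (hA.uniform m hm)]
      simp only [sum_const, Nat.card_Icc, Nat.add_sub_cancel, nsmul_eq_mul]
      exact ENNReal.mul_inv_cancel (by simp; omega) (by simp)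
    · intro i _ j _ hij
      rw [Function.onFun, Set.disjoint_left]
      intro ω h h'
      exact hij (h.symm.trans h')
  have h2 : ∀ᵐ ω ∂μ, ω ∈ ⋃ i ∈ Icc 1 m, {ω | A m ω = i} :=
    (mem_ae_iff_prob_eq_one ((Icc 1 m).measurableSet_biUnion fun i _ => hms i)).2 h1
  filter_upwards [h2] with ω h _
  simp only [Set.mem_iUnion, Set.mem_ofPred_eq, exists_prop, exists_eq_right'] at h
  exact mem_Icc.1 h

theorem IsUniformAttachment.indepFun_prefixSeq (hA : IsUniformAttachment μ A) {n : ℕ}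
    (hn : 1 ≤ n) : IndepFun (A n) (fun ω => prefixSeq n fun k => A k ω) μ := by
  have h := hA.indep.indepFun_finset {n - 1} (range (n - 1)) (by simp)
    (fun k => hA.measurable (k + 1) (by omega))
  have e1 : A n = (fun x : ({n - 1} : Finset ℕ) → ℕ => x ⟨n - 1, by simp⟩) ∘
      fun ω (i : ({n - 1} : Finset ℕ)) => A (i + 1) ω := by
    ext ω; simp [Nat.sub_add_cancel hn]
  have e2 : (fun ω => prefixSeq n fun k => A k ω) =
      (fun (x : (range (n - 1)) → ℕ) (k : Fin n) => if hk : (k : ℕ) = 0 then 0 else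
        x ⟨k - 1, by simp; omega⟩) ∘ fun ω (i : (range (n - 1))) => A (i + 1) ω := by
    ext ω k
    unfold prefixSeq
    simp only [Function.comp]
    split_ifs with hk
    · rfl
    · rw [Nat.sub_add_cancel (by omega)]
  rw [e1, e2]
  exact h.comp (measurable_of_countable _) (measurable_of_countable _)

/-- Averaging over the vertex to which `n + 1` is attached. -/
theorem integral_attach [IsProbabilityMeasure μ] (hA : IsUniformAttachment μ A) {n : ℕ}
    (hn : 1 ≤ n) {h : ℕ → Ω → ℝ} (hh : ∀ i ∈ Icc 1 n, BddMeas (history hA n) (h i)) :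
    ∫ ω, h (A n ω) ω ∂μ = ∫ ω, (n : ℝ)⁻¹ * ∑ i ∈ Icc 1 n, h i ω ∂μ := by
  have hm' : ∀ i ∈ Icc 1 n, Measurable (h i) :=
    fun i hi => (hh i hi).1.mono ((history hA).le n) le_rfl
  have hms : ∀ i, MeasurableSet {ω | A n ω = i} := fun i =>
    hA.measurable n hn (measurableSet_singleton i)
  have hint : ∀ i ∈ Icc 1 n, Integrable (h i) μ := fun i hi =>
    (hh i hi).integrable ((history hA).le n)
  have e1 : ∀ᵐ ω ∂μ, h (A n ω) ω =
      ∑ i ∈ Icc 1 n, (if A n ω = i then (1 : ℝ) else 0) * h i ω := by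
    filter_upwards [hA.ae_isAttachment] with ω hω
    simp only [ite_mul, one_mul, zero_mul]
    rw [sum_ite_eq, if_pos (mem_Icc.2 (hω n hn))]
  have hmi : ∀ i, Measurable fun ω => if A n ω = i then (1 : ℝ) else 0 := fun i =>
    Measurable.ite (hms i) measurable_const measurable_const
  have e2 : ∀ i ∈ Icc 1 n, ∫ ω, (if A n ω = i then (1 : ℝ) else 0) * h i ω ∂μ =
      (n : ℝ)⁻¹ * ∫ ω, h i ω ∂μ := by
    intro i hi
    obtain ⟨g, hg, hgh⟩ := (hh i hi).1.exists_eq_measurable_comp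
    have hind : IndepFun (fun ω => if A n ω = i then (1 : ℝ) else 0) (h i) μ := by
      rw [hgh]
      exact (hA.indepFun_prefixSeq hn).comp (φ := fun x => if x = i then (1 : ℝ) else 0)
        (measurable_of_countable _) hg
    rw [hind.integral_fun_mul_eq_mul_integral (hmi i).aestronglyMeasurable
      (hm' i hi).aestronglyMeasurable]
    congr 1
    have : (fun ω => if A n ω = i then (1 : ℝ) else 0) = {ω | A n ω = i}.indicator 1 := by
      ext ω; simp [Set.indicator]
    rw [this, integral_indicator_one (hms i), measureReal_def, hA.uniform n hn i hi]
    simp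
  rw [integral_congr_ae e1, integral_finsetSum, sum_congr rfl e2, integral_const_mul,
    integral_finsetSum _ hint, mul_sum]
  intro i hi
  obtain ⟨C, hC⟩ := (hh i hi).2
  refine Integrable.of_bound ((hmi i).mul (hm' i hi)).aestronglyMeasurable C
    (Eventually.of_forall fun ω => ?_)
  have := hC ω
  have := (abs_nonneg _).trans this
  split_ifs <;> simpa

/-- Almost surely every vertex has infinitely many children. -/
theorem ae_frequently_attach [IsProbabilityMeasure μ] (hA : IsUniformAttachment μ A) {v : ℕ}
    (hv : 1 ≤ v) : ∀ᵐ ω ∂μ, ∃ᶠ n in atTop, A n ω = v := by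
  have hms : ∀ n : ℕ, MeasurableSet {ω | A (n + 1) ω = v} := fun n =>
    hA.measurable (n + 1) (by omega) (measurableSet_singleton v)
  have hind : iIndepSet (fun n : ℕ => {ω | A (n + 1) ω = v}) μ := by
    rw [iIndepSet_iff_meas_biInter hms]
    intro s
    exact hA.indep.measure_inter_preimage_eq_mul s (sets := fun _ => {v})
      fun _ _ => measurableSet_singleton v
  -- Divergence of the harmonic series, for the second Borel–Cantelli lemma. The shift by `v`
  -- restricts to times at which `v` is already present.
  have hsum : (∑' n : ℕ, μ {ω | A (n + 1) ω = v}) = ⊤ := by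
    by_contra hne
    have h1 : Summable fun n : ℕ => (μ {ω | A (n + 1) ω = v}).toReal :=
      ENNReal.summable_toReal hne
    have h2 : Summable fun n : ℕ => ((n + v : ℕ) + 1 : ℝ)⁻¹ := by
      refine ((summable_nat_add_iff v).2 h1).congr fun n => ?_
      rw [hA.uniform _ (by omega) v (mem_Icc.2 ⟨hv, by omega⟩)]
      simp only [ENNReal.toReal_inv]
      push_cast
      exact_mod_cast (congrArg (·⁻¹) (ENNReal.toReal_natCast (n + v + 1))).symm
    have h3 : Summable fun n : ℕ => ((n : ℕ) + 1 : ℝ)⁻¹ :=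
      (summable_nat_add_iff (f := fun n : ℕ => ((n : ℕ) + 1 : ℝ)⁻¹) v).1 h2
    have h4 : Summable fun n : ℕ => (n : ℝ)⁻¹ :=
      (summable_nat_add_iff 1).1 (by simpa using h3)
    exact Real.not_summable_natCast_inv h4
  have h := measure_limsup_eq_one hms hind hsum
  have h' : ∀ᵐ ω ∂μ, ω ∈ limsup (fun n : ℕ => {ω | A (n + 1) ω = v}) atTop :=
    (mem_ae_iff_prob_eq_one (MeasurableSet.measurableSet_limsup hms)).2 h
  filter_upwards [h'] with ω hω
  rw [mem_limsup_iff_frequently_mem] at hω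
  rw [frequently_atTop] at hω ⊢
  intro N
  obtain ⟨n, hn, h⟩ := hω N
  exact ⟨n + 1, by omega, h⟩

/-- Lévy's zero-one law in the form of a lower bound: if the conditional probability of `E` is
bounded below on `G n` for infinitely many `n`, then `E` occurs. -/
theorem ae_mem_of_frequently_mem [IsProbabilityMeasure μ] {ℱ : Filtration ℕ ‹MeasurableSpace Ω›}
    {E : Set Ω} (hE : MeasurableSet[⨆ n, ℱ n] E) {G : ℕ → Set Ω}
    (hG : ∀ n, MeasurableSet[ℱ n] (G n)) {δ : ℝ} (hδ : 0 < δ)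
    (h : ∀ n, ∀ s, MeasurableSet[ℱ n] s → s ⊆ G n → δ * μ.real s ≤ μ.real (s ∩ E)) :
    ∀ᵐ ω ∂μ, (∃ᶠ n in atTop, ω ∈ G n) → ω ∈ E := by
  have hE' : MeasurableSet E := (iSup_le fun n => ℱ.le n : ⨆ n, ℱ n ≤ _) _ hE
  have hg : Integrable (E.indicator (1 : Ω → ℝ)) μ :=
    (integrable_const 1).indicator hE'
  -- The hypothesis on all `s ⊆ G n` is the integrated form of this bound on the conditional
  -- probability.
  have key : ∀ n, ∀ᵐ ω ∂μ, ω ∈ G n → δ ≤ (μ[E.indicator (1 : Ω → ℝ) | ℱ n]) ω := by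
    intro n
    have hGn : MeasurableSet (G n) := ℱ.le n _ (hG n)
    have : (fun ω => (G n).indicator (fun _ => δ) ω) ≤ᵐ[μ]
        fun ω => (G n).indicator (μ[E.indicator (1 : Ω → ℝ) | ℱ n]) ω := by
      refine ae_le_of_ae_le_trim (hm := ℱ.le n) ?_
      refine ae_le_of_forall_setIntegral_le ?_ ?_ ?_
      · exact ((integrable_const δ).indicator hGn).trim (ℱ.le n)
          (stronglyMeasurable_const.indicator (hG n))
      · exact ((integrable_condExp).indicator hGn).trim (ℱ.le n)
          (stronglyMeasurable_condExp.indicator (hG n))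
      · intro s hs _
        rw [← setIntegral_trim (ℱ.le n) (stronglyMeasurable_const.indicator (hG n)) hs,
          ← setIntegral_trim (ℱ.le n) (stronglyMeasurable_condExp.indicator (hG n)) hs,
          setIntegral_indicator hGn, setIntegral_indicator hGn,
          setIntegral_condExp (ℱ.le n) hg (hs.inter (hG n)), setIntegral_const,
          setIntegral_indicator hE']
        simp only [Pi.one_apply, integral_const, smul_eq_mul, mul_one]
        rw [measureReal_restrict_apply MeasurableSet.univ, Set.univ_inter, mul_comm]
        exact h n _ (hs.inter (hG n)) Set.inter_subset_right
    filter_upwards [this] with ω hω hmem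
    simpa [Set.indicator_of_mem hmem] using hω
  -- The conditional probabilities converge to the indicator of `E`; a limit `0` is incompatible
  -- with being at least `δ` infinitely often.
  have hl := tendsto_ae_condExp (μ := μ) (ℱ := ℱ) (E.indicator (1 : Ω → ℝ))
  have hself : μ[E.indicator (1 : Ω → ℝ) | ⨆ n, ℱ n] = E.indicator (1 : Ω → ℝ) :=
    condExp_of_stronglyMeasurable (iSup_le fun n => ℱ.le n)
      (stronglyMeasurable_one.indicator hE) hg
  rw [hself] at hl
  filter_upwards [hl, ae_all_iff.2 key] with ω h1 h2 h3
  by_contra hω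
  rw [Set.indicator_of_notMem hω] at h1
  obtain ⟨n, hn1, hn2⟩ := (h3.and_eventually (h1.eventually_lt_const hδ)).exists
  exact absurd (h2 n hn1) (not_le.2 hn2)

end URRT

/-! ### Bounded martingales driven by the attachment, and their moments -/

namespace URRT

open Finset MeasureTheory ProbabilityTheory Filter Topology

variable {Ω : Type*} [MeasurableSpace Ω] {μ : Measure Ω} {A : ℕ → Ω → ℕ}

/-- A bounded functional `Y n` of the tree on `[n]`, `n ≥ n₀`, such that `Y (n + 1)` is `y n i` if
`n + 1` is attached to `i`, and whose mean over `i` is `Y n`. -/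
structure IsAveraging (hA : IsUniformAttachment μ A) (n₀ : ℕ) (Y : ℕ → Ω → ℝ)
    (y : ℕ → ℕ → Ω → ℝ) : Prop where
  one_le : 1 ≤ n₀
  bddMeas : ∀ m, n₀ ≤ m → BddMeas (history hA m) (Y m)
  bddMeas_step : ∀ m, n₀ ≤ m → ∀ i ∈ Icc 1 m, BddMeas (history hA m) (y m i)
  bdd : ∃ C, ∀ m, n₀ ≤ m → ∀ ω, |Y m ω| ≤ C
  step : ∀ m, n₀ ≤ m → ∀ᵐ ω ∂μ, Y (m + 1) ω = y m (A m ω) ω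
  sum_eq : ∀ m, n₀ ≤ m → ∀ ω, ∑ i ∈ Icc 1 m, y m i ω = m * Y m ω

namespace IsAveraging

variable {hA : IsUniformAttachment μ A} {n₀ : ℕ} {Y : ℕ → Ω → ℝ} {y : ℕ → ℕ → Ω → ℝ} {ρ : Ω → ℝ}

/-- A weight `ρ` known at time `m` passes through the average over the attachment vertex. Such
weights replace conditional expectations; the powers `1`, `2` and `4` are used. -/
theorem integral_mul_pow [IsProbabilityMeasure μ] (hY : IsAveraging hA n₀ Y y) {m : ℕ} (hm : n₀ ≤ m)
    (hρ : BddMeas (history hA m) ρ) (k : ℕ) :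
    ∫ ω, ρ ω * Y (m + 1) ω ^ k ∂μ =
      ∫ ω, ρ ω * ((m : ℝ)⁻¹ * ∑ i ∈ Icc 1 m, y m i ω ^ k) ∂μ := by
  have h := integral_attach hA (hY.one_le.trans hm) (h := fun i ω => ρ ω * y m i ω ^ k)
    fun i hi => hρ.mul ((hY.bddMeas_step m hm i hi).pow k)
  rw [integral_congr_ae (g := fun ω => ρ ω * y m (A m ω) ω ^ k)]
  · rw [h]
    refine integral_congr_ae (Eventually.of_forall fun ω => ?_)
    simp only [← mul_sum]
    ring
  · filter_upwards [hY.step m hm] with ω hω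
    rw [hω]

theorem mean_eq (hY : IsAveraging hA n₀ Y y) {m : ℕ} (hm : n₀ ≤ m) (ω : Ω) :
    (m : ℝ)⁻¹ * ∑ i ∈ Icc 1 m, y m i ω = Y m ω := by
  have : (m : ℝ) ≠ 0 := by have := hY.one_le; norm_cast; omega
  rw [hY.sum_eq m hm, inv_mul_cancel_left₀ this]

theorem integral_mul_succ [IsProbabilityMeasure μ] (hY : IsAveraging hA n₀ Y y) {m : ℕ}
    (hm : n₀ ≤ m)
    (hρ : BddMeas (history hA m) ρ) :
    ∫ ω, ρ ω * Y (m + 1) ω ∂μ = ∫ ω, ρ ω * Y m ω ∂μ := by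
  have := hY.integral_mul_pow hm hρ 1
  simpa only [pow_one, hY.mean_eq hm] using this

theorem integral_mul_eq [IsProbabilityMeasure μ] (hY : IsAveraging hA n₀ Y y) {n m : ℕ}
    (hn : n₀ ≤ n) (h : n ≤ m)
    (hρ : BddMeas (history hA n) ρ) :
    ∫ ω, ρ ω * Y m ω ∂μ = ∫ ω, ρ ω * Y n ω ∂μ := by
  induction m, h using Nat.le_induction with
  | base => rfl
  | succ m h ih =>
    rw [hY.integral_mul_succ (hn.trans h) (hρ.mono ((history hA).mono h)), ih]

/-- Bounded martingale convergence, started at `n₀`. Measurability of the limit in the generated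
σ-algebra is what the zero-one law requires. -/
theorem exists_tendsto [IsProbabilityMeasure μ] (hY : IsAveraging hA n₀ Y y) :
    ∃ X : Ω → ℝ, Measurable[⨆ n, history hA n] X ∧
      ∀ᵐ ω ∂μ, Tendsto (fun n => Y n ω) atTop (𝓝 (X ω)) := by
  let ℱ : Filtration ℕ ‹MeasurableSpace Ω› :=
    { seq := fun n => history hA (n + n₀)
      mono' := fun i j h => (history hA).mono (by omega)
      le' := fun n => (history hA).le _ }
  have hint : ∀ k, Integrable (Y (k + n₀)) μ := fun k =>
    (hY.bddMeas (k + n₀) (by omega)).integrable ((history hA).le _)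
  have hmart : Submartingale (fun k => Y (k + n₀)) ℱ μ := by
    refine submartingale_of_setIntegral_le_succ
      (fun k => (hY.bddMeas (k + n₀) (by omega)).1.stronglyMeasurable) hint fun k s hs => ?_
    have h := hY.integral_mul_succ (m := k + n₀) (by omega)
      ((BddMeas.const (1 : ℝ)).indicator hs)
    have hs' : MeasurableSet s := ℱ.le k s hs
    rw [← integral_indicator hs', ← integral_indicator hs']
    have e : ∀ f : Ω → ℝ, s.indicator f = fun ω => s.indicator (fun _ => (1 : ℝ)) ω * f ω := by
      intro f; ext ω; by_cases hω : ω ∈ s <;> simp [hω]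
    rw [e (Y (k + n₀)), e (Y (k + 1 + n₀)), show k + 1 + n₀ = k + n₀ + 1 by omega]
    exact h.ge
  obtain ⟨C, hC⟩ := hY.bdd
  have hbdd : ∀ k, eLpNorm (Y (k + n₀)) 1 μ ≤ (C.toNNReal : ENNReal) := by
    intro k
    refine (eLpNorm_le_of_ae_bound (C := C) (Eventually.of_forall fun ω => ?_)).trans ?_
    · exact hC _ (by omega) ω
    · simp [ENNReal.ofReal]
  refine ⟨Filtration.limitProcess (fun k => Y (k + n₀)) ℱ μ, ?_, ?_⟩
  · have h : (⨆ n, ℱ n) ≤ ⨆ n, history hA n :=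
      iSup_le fun n => le_iSup (fun k => (history hA) k) (n + n₀)
    exact Filtration.stronglyMeasurable_limitProcess.measurable.mono h le_rfl
  · filter_upwards [hmart.ae_tendsto_limitProcess hbdd] with ω hω
    exact (tendsto_add_atTop_iff_nat n₀).1 hω

theorem tendsto_integral_pow [IsProbabilityMeasure μ] (hY : IsAveraging hA n₀ Y y) {X : Ω → ℝ}
    (hX : ∀ᵐ ω ∂μ, Tendsto (fun n => Y n ω) atTop (𝓝 (X ω))) {n : ℕ}
    (hρ : BddMeas (history hA n) ρ) (k : ℕ) :
    Tendsto (fun m => ∫ ω, ρ ω * Y m ω ^ k ∂μ) atTop (𝓝 (∫ ω, ρ ω * X ω ^ k ∂μ)) := by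
  obtain ⟨C, hC⟩ := hY.bdd
  obtain ⟨D, hD⟩ := hρ.2
  refine tendsto_integral_filter_of_dominated_convergence (fun _ => D * C ^ k) ?_ ?_
    (integrable_const _) ?_
  · filter_upwards [eventually_ge_atTop n₀] with m hm
    exact ((hρ.1.mono ((history hA).le n) le_rfl).mul
      (((hY.bddMeas m hm).1.mono ((history hA).le m) le_rfl).pow_const k)).aestronglyMeasurable
  · filter_upwards [eventually_ge_atTop n₀] with m hm
    refine Eventually.of_forall fun ω => ?_
    rw [Real.norm_eq_abs, abs_mul, abs_pow]
    have := hC m hm ω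
    exact mul_le_mul (hD ω) (pow_le_pow_left₀ (abs_nonneg _) this k) (by positivity)
      ((abs_nonneg _).trans (hD ω))
  · filter_upwards [hX] with ω hω
    exact (hω.pow k).const_mul _

theorem integrable_mul_limit_pow [IsProbabilityMeasure μ] (hY : IsAveraging hA n₀ Y y) {X : Ω → ℝ}
    (hXm : Measurable[⨆ n, history hA n] X)
    (hX : ∀ᵐ ω ∂μ, Tendsto (fun n => Y n ω) atTop (𝓝 (X ω))) {n : ℕ}
    (hρ : BddMeas (history hA n) ρ) (k : ℕ) : Integrable (fun ω => ρ ω * X ω ^ k) μ := by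
  obtain ⟨C, hC⟩ := hY.bdd
  obtain ⟨D, hD⟩ := hρ.2
  have hXm' : Measurable X := hXm.mono (iSup_le fun n => (history hA).le n) le_rfl
  refine Integrable.of_bound (((hρ.1.mono ((history hA).le n) le_rfl).mul
      (hXm'.pow_const k)).aestronglyMeasurable) (D * C ^ k) ?_
  filter_upwards [hX] with ω hω
  have : |X ω| ≤ C := le_of_tendsto hω.abs <| by
    filter_upwards [eventually_ge_atTop n₀] with m hm using hC m hm ω
  rw [Real.norm_eq_abs, abs_mul, abs_pow]
  exact mul_le_mul (hD ω) (pow_le_pow_left₀ (abs_nonneg _) this k) (by positivity)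
      ((abs_nonneg _).trans (hD ω))

/-! ### Moments -/

/-- The conditional variance of `Y (m + 1)` given the tree on `[m]`. -/
noncomputable def stepVar (Y : ℕ → Ω → ℝ) (y : ℕ → ℕ → Ω → ℝ) (m : ℕ) (ω : Ω) : ℝ :=
  (m : ℝ)⁻¹ * ∑ i ∈ Icc 1 m, (y m i ω - Y m ω) ^ 2

theorem bddMeas_stepVar (hY : IsAveraging hA n₀ Y y) {m : ℕ} (hm : n₀ ≤ m) :
    BddMeas (history hA m) (stepVar Y y m) :=
  (BddMeas.const _).mul (BddMeas.sum fun i hi =>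
    ((hY.bddMeas_step m hm i hi).sub (hY.bddMeas m hm)).pow 2)

theorem mean_const (hY : IsAveraging hA n₀ Y y) {m : ℕ} (hm : n₀ ≤ m) (c : ℝ) :
    (m : ℝ)⁻¹ * ∑ _i ∈ Icc 1 m, c = c := by
  have : (m : ℝ) ≠ 0 := by have := hY.one_le; norm_cast; omega
  simp [inv_mul_cancel_left₀ this]

theorem mean_sq (hY : IsAveraging hA n₀ Y y) {m : ℕ} (hm : n₀ ≤ m) (ω : Ω) :
    (m : ℝ)⁻¹ * ∑ i ∈ Icc 1 m, y m i ω ^ 2 = Y m ω ^ 2 + stepVar Y y m ω := by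
  have h : ∀ i, y m i ω ^ 2 = Y m ω ^ 2 + (y m i ω - Y m ω) ^ 2 + 2 * Y m ω * y m i ω
      - 2 * Y m ω * Y m ω := fun i => by ring
  have h0 := hY.mean_const hm (Y m ω ^ 2)
  have h1 := hY.mean_const hm (2 * Y m ω * Y m ω)
  have h2 := hY.mean_eq hm ω
  rw [sum_congr rfl fun i _ => h i, sum_sub_distrib, sum_add_distrib, sum_add_distrib, mul_sub,
    mul_add, mul_add, ← mul_sum, h0, h1, stepVar]
  linear_combination 2 * Y m ω * h2

theorem mean_fourth_le (hY : IsAveraging hA n₀ Y y) {m : ℕ} (hm : n₀ ≤ m) (ω : Ω) {ε : ℝ}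
    (hε : ∀ i ∈ Icc 1 m, (y m i ω - Y m ω) ^ 2 ≤ ε) :
    (m : ℝ)⁻¹ * ∑ i ∈ Icc 1 m, y m i ω ^ 4 ≤ Y m ω ^ 4 + 8 * ε * Y m ω ^ 2 + 3 * ε ^ 2 := by
  have h : ∀ i ∈ Icc 1 m, y m i ω ^ 4 ≤ (Y m ω ^ 4 + 8 * ε * Y m ω ^ 2 + 3 * ε ^ 2)
      + 4 * Y m ω ^ 3 * y m i ω - 4 * Y m ω ^ 3 * Y m ω := by
    intro i hi
    obtain ⟨d, hd⟩ : ∃ d, d = y m i ω - Y m ω := ⟨_, rfl⟩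
    have h1 := hε i hi
    rw [← hd] at h1
    have h2 : y m i ω = Y m ω + d := by rw [hd]; ring
    rw [h2]
    have h3 : d ^ 2 * d ^ 2 ≤ ε * ε := mul_le_mul h1 h1 (sq_nonneg _) ((sq_nonneg _).trans h1)
    have h4 : Y m ω ^ 2 * d ^ 2 ≤ Y m ω ^ 2 * ε := mul_le_mul_of_nonneg_left h1 (sq_nonneg _)
    -- The cubic term is absorbed into its neighbours, giving `8 = 6 + 2` and `3 = 1 + 2`; the
    -- linear term in `d` averages to zero.
    have h5 : 4 * Y m ω * d ^ 3 ≤ 2 * Y m ω ^ 2 * d ^ 2 + 2 * d ^ 4 := by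
      nlinarith [mul_nonneg (sq_nonneg d) (sq_nonneg (Y m ω - d))]
    nlinarith
  have h2 := hY.mean_eq hm ω
  calc _ ≤ (m : ℝ)⁻¹ * ∑ i ∈ Icc 1 m, ((Y m ω ^ 4 + 8 * ε * Y m ω ^ 2 + 3 * ε ^ 2)
      + 4 * Y m ω ^ 3 * y m i ω - 4 * Y m ω ^ 3 * Y m ω) := by
        gcongr with i hi; exact h i hi
    _ = _ := by
        rw [sum_sub_distrib, sum_add_distrib, ← mul_sum, mul_sub, mul_add, hY.mean_const hm,
          hY.mean_const hm]
        linear_combination 4 * Y m ω ^ 3 * h2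

theorem integral_mul_sq_succ [IsProbabilityMeasure μ] (hY : IsAveraging hA n₀ Y y) {m : ℕ}
    (hm : n₀ ≤ m)
    (hρ : BddMeas (history hA m) ρ) :
    ∫ ω, ρ ω * Y (m + 1) ω ^ 2 ∂μ =
      ∫ ω, ρ ω * Y m ω ^ 2 ∂μ + ∫ ω, ρ ω * stepVar Y y m ω ∂μ := by
  rw [hY.integral_mul_pow hm hρ, ← integral_add
    ((hρ.mul ((hY.bddMeas m hm).pow 2)).integrable ((history hA).le m))
    ((hρ.mul (hY.bddMeas_stepVar hm)).integrable ((history hA).le m))]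
  simp only [hY.mean_sq hm, mul_add]

variable {K : ℝ}

/-- The increments at step `m` are of order `1 / m`. -/
def SmallSteps (n₀ : ℕ) (Y : ℕ → Ω → ℝ) (y : ℕ → ℕ → Ω → ℝ) (K : ℝ) : Prop :=
  ∀ m, n₀ ≤ m → ∀ ω, ∀ i ∈ Icc 1 m, (y m i ω - Y m ω) ^ 2 ≤ K * ((m : ℝ)⁻¹ - (m + 1 : ℝ)⁻¹)

theorem stepVar_nonneg {Ω : Type*} {Y : ℕ → Ω → ℝ} {y : ℕ → ℕ → Ω → ℝ} (m : ℕ)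
    (ω : Ω) : 0 ≤ stepVar Y y m ω :=
  mul_nonneg (by positivity) (sum_nonneg fun _ _ => sq_nonneg _)

theorem stepVar_le (hY : IsAveraging hA n₀ Y y) (hK : SmallSteps n₀ Y y K) {m : ℕ}
    (hm : n₀ ≤ m) (ω : Ω) : stepVar Y y m ω ≤ K * ((m : ℝ)⁻¹ - (m + 1 : ℝ)⁻¹) := by
  rw [← hY.mean_const hm (K * ((m : ℝ)⁻¹ - (m + 1 : ℝ)⁻¹)), stepVar]
  gcongr with i hi
  exact hK m hm ω i hi

/-- Increments are uncorrelated, so variances add, and the bounds `K (1 / m - 1 / (m + 1))`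
telescope. -/
theorem integral_mul_sq_le [IsProbabilityMeasure μ] (hY : IsAveraging hA n₀ Y y)
    (hK : SmallSteps n₀ Y y K) {n m : ℕ}
    (hn : n₀ ≤ n) (h : n ≤ m) (hρ : BddMeas (history hA n) ρ) (hρ0 : ∀ ω, 0 ≤ ρ ω) :
    ∫ ω, ρ ω * Y m ω ^ 2 ∂μ ≤
      ∫ ω, ρ ω * Y n ω ^ 2 ∂μ + K * ((n : ℝ)⁻¹ - (m : ℝ)⁻¹) * ∫ ω, ρ ω ∂μ := by
  induction m, h using Nat.le_induction with
  | base => simp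
  | succ m h ih =>
    have hρ' := hρ.mono ((history hA).mono h)
    have hm := hn.trans h
    have : ∫ ω, ρ ω * stepVar Y y m ω ∂μ ≤ K * ((m : ℝ)⁻¹ - (m + 1 : ℝ)⁻¹) * ∫ ω, ρ ω ∂μ := by
      rw [mul_comm, ← integral_mul_const]
      refine integral_mono ((hρ'.mul (hY.bddMeas_stepVar hm)).integrable ((history hA).le m))
        ((hρ'.mul (BddMeas.const _)).integrable ((history hA).le m)) fun ω => ?_
      exact mul_le_mul_of_nonneg_left (hY.stepVar_le hK hm ω) (hρ0 ω)
    rw [hY.integral_mul_sq_succ hm hρ']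
    push_cast
    linarith

/-- With `ε = K (1 / m - 1 / (m + 1))`, one step adds at most `8ε ∫ ρ Y_m^2 + 3ε^2 ∫ ρ`. The
second-moment bound and `ε ≤ K / n` turn this into `ε` times a fixed factor with `11 = 8 + 3`, which
telescopes. -/
theorem integral_mul_fourth_le [IsProbabilityMeasure μ] (hY : IsAveraging hA n₀ Y y) (hK0 : 0 ≤ K)
    (hK : SmallSteps n₀ Y y K) {n m : ℕ}
    (hn : n₀ ≤ n) (h : n ≤ m) (hρ : BddMeas (history hA n) ρ) (hρ0 : ∀ ω, 0 ≤ ρ ω) :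
    ∫ ω, ρ ω * Y m ω ^ 4 ∂μ ≤ ∫ ω, ρ ω * Y n ω ^ 4 ∂μ + K * ((n : ℝ)⁻¹ - (m : ℝ)⁻¹) *
      (8 * ∫ ω, ρ ω * Y n ω ^ 2 ∂μ + 11 * (K * (n : ℝ)⁻¹) * ∫ ω, ρ ω ∂μ) := by
  induction m, h using Nat.le_induction with
  | base => simp
  | succ m h ih =>
    have hρ' := hρ.mono ((history hA).mono h)
    have hm := hn.trans h
    have hn1 : (0 : ℝ) < n := by have := hY.one_le; norm_cast; omega
    have hnm : (n : ℝ) ≤ m := by exact_mod_cast h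
    have hm1 : (0 : ℝ) < m := hn1.trans_le hnm
    obtain ⟨ε, hε⟩ : ∃ ε, ε = K * ((m : ℝ)⁻¹ - (m + 1 : ℝ)⁻¹) := ⟨_, rfl⟩
    have hinv : (m + 1 : ℝ)⁻¹ ≤ (m : ℝ)⁻¹ := by gcongr; linarith
    have hinv' : (m : ℝ)⁻¹ ≤ (n : ℝ)⁻¹ := by gcongr
    have hinv0 : (0 : ℝ) < (m + 1 : ℝ)⁻¹ := by positivity
    have hε0 : 0 ≤ ε := by rw [hε]; exact mul_nonneg hK0 (by linarith)
    have hεn : ε ≤ K * (n : ℝ)⁻¹ := by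
      rw [hε]; exact mul_le_mul_of_nonneg_left (by linarith) hK0
    have hsq : ∫ ω, ρ ω * Y m ω ^ 2 ∂μ ≤
        ∫ ω, ρ ω * Y n ω ^ 2 ∂μ + K * (n : ℝ)⁻¹ * ∫ ω, ρ ω ∂μ := by
      refine (hY.integral_mul_sq_le hK hn h hρ hρ0).trans ?_
      have h0 : 0 ≤ ∫ ω, ρ ω ∂μ := integral_nonneg hρ0
      gcongr
      have : (0 : ℝ) ≤ (m : ℝ)⁻¹ := by positivity
      linarith
    have h0 : 0 ≤ ∫ ω, ρ ω ∂μ := integral_nonneg hρ0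
    have i4 := (hρ'.mul ((hY.bddMeas m hm).pow 4)).integrable (μ := μ) ((history hA).le m)
    have i2 := (hρ'.mul ((hY.bddMeas m hm).pow 2)).integrable (μ := μ) ((history hA).le m)
    have i0 := hρ'.integrable (μ := μ) ((history hA).le m)
    have i42 : Integrable (fun ω => ρ ω * Y m ω ^ 4 + 8 * ε * (ρ ω * Y m ω ^ 2)) μ :=
      i4.add (i2.const_mul _)
    have hstep : ∫ ω, ρ ω * Y (m + 1) ω ^ 4 ∂μ ≤ ∫ ω, ρ ω * Y m ω ^ 4 ∂μ +
        8 * ε * ∫ ω, ρ ω * Y m ω ^ 2 ∂μ + 3 * ε ^ 2 * ∫ ω, ρ ω ∂μ := by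
      rw [hY.integral_mul_pow hm hρ', ← integral_const_mul, ← integral_const_mul,
        ← integral_add i4 (i2.const_mul _), ← integral_add i42 (i0.const_mul _)]
      refine integral_mono ((hρ'.mul ((BddMeas.const _).mul (BddMeas.sum fun i hi =>
        (hY.bddMeas_step m hm i hi).pow 4))).integrable ((history hA).le m))
        (i42.add (i0.const_mul _)) fun ω => ?_
      have h1 := mul_le_mul_of_nonneg_left (hY.mean_fourth_le hm ω (ε := ε)
        (by rw [hε]; exact hK m hm ω)) (hρ0 ω)
      dsimp only
      linarith
    have e1 : 8 * ε * ∫ ω, ρ ω * Y m ω ^ 2 ∂μ ≤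
        8 * ε * (∫ ω, ρ ω * Y n ω ^ 2 ∂μ + K * (n : ℝ)⁻¹ * ∫ ω, ρ ω ∂μ) := by gcongr
    have e2 : 3 * ε ^ 2 * ∫ ω, ρ ω ∂μ ≤ 3 * (ε * (K * (n : ℝ)⁻¹)) * ∫ ω, ρ ω ∂μ := by
      rw [sq]; gcongr
    have e3 : K * ((n : ℝ)⁻¹ - ((m + 1 : ℕ) : ℝ)⁻¹) = K * ((n : ℝ)⁻¹ - (m : ℝ)⁻¹) + ε := by
      rw [hε]; push_cast; ring
    rw [e3]
    linarith

/-- The variance bound is only required where `ρ ≠ 0`, so a weight supported on an event of time `n`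
localises the estimate to that event. -/
theorem le_integral_mul_sq [IsProbabilityMeasure μ] (hY : IsAveraging hA n₀ Y y) {n m : ℕ} {c : ℝ}
    (hn : n₀ ≤ n) (h : n ≤ m) (hρ : BddMeas (history hA n) ρ) (hρ0 : ∀ ω, 0 ≤ ρ ω)
    (hc : ∀ k, n ≤ k → k < m → ∀ᵐ ω ∂μ, ρ ω ≠ 0 →
      c * ((k : ℝ)⁻¹ - (k + 1 : ℝ)⁻¹) ≤ stepVar Y y k ω) :
    ∫ ω, ρ ω * Y n ω ^ 2 ∂μ + c * ((n : ℝ)⁻¹ - (m : ℝ)⁻¹) * ∫ ω, ρ ω ∂μ ≤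
      ∫ ω, ρ ω * Y m ω ^ 2 ∂μ := by
  induction m, h using Nat.le_induction with
  | base => simp
  | succ m h ih =>
    have hρ' := hρ.mono ((history hA).mono h)
    have hm := hn.trans h
    have : c * ((m : ℝ)⁻¹ - (m + 1 : ℝ)⁻¹) * ∫ ω, ρ ω ∂μ ≤ ∫ ω, ρ ω * stepVar Y y m ω ∂μ := by
      rw [mul_comm, ← integral_mul_const]
      refine integral_mono_ae ((hρ'.mul (BddMeas.const _)).integrable ((history hA).le m))
        ((hρ'.mul (hY.bddMeas_stepVar hm)).integrable ((history hA).le m)) ?_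
      filter_upwards [hc m h (by omega)] with ω hω
      by_cases h0 : ρ ω = 0
      · simp [h0]
      · exact mul_le_mul_of_nonneg_left (hω h0) (hρ0 ω)
    have ih := ih fun k h1 h2 => hc k h1 (by omega)
    rw [hY.integral_mul_sq_succ hm hρ']
    push_cast
    linarith

theorem integral_mul_sq_mono [IsProbabilityMeasure μ] (hY : IsAveraging hA n₀ Y y) {n m : ℕ}
    (hn : n₀ ≤ n) (h : n ≤ m) {k : ℕ} (hk : k ≤ n) (hρ : BddMeas (history hA k) ρ)
    (hρ0 : ∀ ω, 0 ≤ ρ ω) :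
    ∫ ω, ρ ω * Y n ω ^ 2 ∂μ ≤ ∫ ω, ρ ω * Y m ω ^ 2 ∂μ := by
  have := hY.le_integral_mul_sq (c := 0) hn h (hρ.mono ((history hA).mono hk)) hρ0
    fun k _ _ => Eventually.of_forall fun ω _ => by simpa using stepVar_nonneg k ω
  simpa using this

/-- If the conditional variance over the period from `n` to `2n` is of order `1 / n` infinitely
often, then the limit does not vanish. -/
theorem ae_limit_ne_zero [IsProbabilityMeasure μ] (hY : IsAveraging hA n₀ Y y) (hK0 : 0 < K)
    (hK : SmallSteps n₀ Y y K)
    {X : Ω → ℝ} (hXm : Measurable[⨆ n, history hA n] X)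
    (hX : ∀ᵐ ω ∂μ, Tendsto (fun n => Y n ω) atTop (𝓝 (X ω))) {c : ℝ} (hc0 : 0 < c)
    {G : ℕ → Set Ω} (hG : ∀ n, MeasurableSet[history hA n] (G n))
    (hn : ∀ n, ∀ ω ∈ G n, n₀ ≤ n)
    (hc : ∀ n k, n ≤ k → k < 2 * n → ∀ᵐ ω ∂μ, ω ∈ G n →
      c * ((k : ℝ)⁻¹ - (k + 1 : ℝ)⁻¹) ≤ stepVar Y y k ω) :
    ∀ᵐ ω ∂μ, (∃ᶠ n in atTop, ω ∈ G n) → X ω ≠ 0 := by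
  -- Chosen so that `θ (Y_n^2 + K / n) ≤ Y_n^2 + c / (2n)`.
  obtain ⟨θ, hθ0, hθ1, hθc⟩ : ∃ θ : ℝ, 0 < θ ∧ θ ≤ 1 ∧ θ * K ≤ c / 2 := by
    refine ⟨min 1 (c / (2 * K)), by positivity, min_le_left _ _, ?_⟩
    calc _ ≤ c / (2 * K) * K := by gcongr; exact min_le_right _ _
      _ = c / 2 := by field_simp
  have hE : MeasurableSet[⨆ n, history hA n] {ω | X ω ≠ 0} :=
    (hXm (measurableSet_singleton 0)).compl
  have hE' : MeasurableSet {ω | X ω ≠ 0} :=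
    (iSup_le fun n => (history hA).le n : ⨆ n, history hA n ≤ _) _ hE
  -- Put `q = Y_n^2 + K / n`. Given the tree on `[n]`, `X^2` has mean at least `θ q` and `X^4` mean
  -- at most `11 q^2`. Integrating `1_{X ≠ 0} ≥ 2τX^2 - τ^2X^4` with `τ = κ / q` gives `2θκ -
  -- 11κ^2`, whose maximum `θ^2 / 11` is attained at `κ = θ / 11`.
  refine ae_mem_of_frequently_mem hE hG (δ := θ ^ 2 / 11) (by positivity) fun n s hs hsG => ?_
  rcases s.eq_empty_or_nonempty with rfl | ⟨ω₀, hω₀⟩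
  · simp
  have hn := hn n ω₀ (hsG hω₀)
  have hn1 : (0 : ℝ) < n := by have := hY.one_le; norm_cast; omega
  have hs' : MeasurableSet s := (history hA).le n s hs
  obtain ⟨q, hq⟩ : ∃ q : Ω → ℝ, q = fun ω => Y n ω ^ 2 + K * (n : ℝ)⁻¹ := ⟨_, rfl⟩
  have hqK : ∀ ω, K * (n : ℝ)⁻¹ ≤ q ω := fun ω => by
    rw [hq]; exact le_add_of_nonneg_left (sq_nonneg _)
  have hKn : 0 < K * (n : ℝ)⁻¹ := by positivity
  have hq0 : ∀ ω, 0 < q ω := fun ω => hKn.trans_le (hqK ω)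
  have hqm : BddMeas (history hA n) q := by
    rw [hq]; exact ((hY.bddMeas n hn).pow 2).add (BddMeas.const _)
  have ht : BddMeas (history hA n) fun ω => (q ω)⁻¹ := by
    refine ⟨hqm.1.inv, (K * (n : ℝ)⁻¹)⁻¹, fun ω => ?_⟩
    rw [abs_of_pos (inv_pos.2 (hq0 ω))]
    exact inv_anti₀ hKn (hqK ω)
  obtain ⟨κ, hκ⟩ : ∃ κ : ℝ, κ = θ / 11 := ⟨_, rfl⟩
  have hκ0 : 0 < κ := by rw [hκ]; positivity
  obtain ⟨ρ₁, hρ₁⟩ : ∃ ρ : Ω → ℝ, ρ = s.indicator fun ω => κ * (q ω)⁻¹ := ⟨_, rfl⟩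
  obtain ⟨ρ₂, hρ₂⟩ : ∃ ρ : Ω → ℝ, ρ = s.indicator fun ω => (κ * (q ω)⁻¹) ^ 2 := ⟨_, rfl⟩
  have b₁ : BddMeas (history hA n) ρ₁ := by
    rw [hρ₁]; exact ((BddMeas.const κ).mul ht).indicator hs
  have b₂ : BddMeas (history hA n) ρ₂ := by
    rw [hρ₂]; exact (((BddMeas.const κ).mul ht).pow 2).indicator hs
  have p₁ : ∀ ω, 0 ≤ ρ₁ ω := fun ω => by
    rw [hρ₁]; exact Set.indicator_nonneg (fun ω _ => by have := hq0 ω; positivity) ω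
  have p₂ : ∀ ω, 0 ≤ ρ₂ ω := fun ω => by
    rw [hρ₂]; exact Set.indicator_nonneg (fun ω _ => by positivity) ω
  have hle := (history hA).le n
  -- second moment
  have m2 : θ * κ * μ.real s ≤ ∫ ω, ρ₁ ω * X ω ^ 2 ∂μ := by
    have h1 : ∀ m, 2 * n ≤ m → θ * κ * μ.real s ≤ ∫ ω, ρ₁ ω * Y m ω ^ 2 ∂μ := by
      intro m hm
      -- The variance gained from `n` to `2n` is at least `c / (2n)`; afterwards monotonicity
      -- suffices.
      refine le_trans ?_ (hY.integral_mul_sq_mono (n := 2 * n) (by omega) hm (k := n)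
        (by omega) b₁ p₁)
      refine le_trans ?_ (hY.le_integral_mul_sq (c := c) hn (by omega) b₁ p₁ fun k h1 h2 => ?_)
      · have e : (n : ℝ)⁻¹ - ((2 * n : ℕ) : ℝ)⁻¹ = (n : ℝ)⁻¹ / 2 := by
          push_cast; field_simp; norm_num
        rw [e, mul_comm _ (∫ ω, ρ₁ ω ∂μ), ← integral_mul_const,
          ← integral_add ((b₁.mul ((hY.bddMeas n hn).pow 2)).integrable hle)
            ((b₁.mul (BddMeas.const _)).integrable hle)]
        have e2 : θ * κ * μ.real s = ∫ ω, s.indicator (fun _ => θ * κ) ω ∂μ := by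
          rw [integral_indicator hs', setIntegral_const]; simp [mul_comm]
        rw [e2]
        refine integral_mono (((BddMeas.const _).indicator hs).integrable hle)
          (((b₁.mul ((hY.bddMeas n hn).pow 2)).add (b₁.mul (BddMeas.const _))).integrable hle)
          fun ω => ?_
        by_cases hω : ω ∈ s
        · simp only [hρ₁, Set.indicator_of_mem hω]
          have h3 : θ * q ω ≤ Y n ω ^ 2 + c * ((n : ℝ)⁻¹ / 2) := by
            rw [hq]
            have : θ * Y n ω ^ 2 ≤ 1 * Y n ω ^ 2 := by gcongr
            have : θ * K * (n : ℝ)⁻¹ ≤ c / 2 * (n : ℝ)⁻¹ := by gcongr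
            linarith
          have h4 : 0 < κ * (q ω)⁻¹ := mul_pos hκ0 (inv_pos.2 (hq0 ω))
          calc θ * κ = κ * (q ω)⁻¹ * (θ * q ω) := by
                have := (hq0 ω).ne'; field_simp
            _ ≤ κ * (q ω)⁻¹ * (Y n ω ^ 2 + c * ((n : ℝ)⁻¹ / 2)) :=
                mul_le_mul_of_nonneg_left h3 h4.le
            _ = _ := by ring
        · simp [hρ₁, hω]
      · filter_upwards [hc n k h1 h2] with ω hω h0
        refine hω (hsG ?_)
        by_contra h3
        exact h0 (by rw [hρ₁, Set.indicator_of_notMem h3])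
    exact ge_of_tendsto (hY.tendsto_integral_pow hX b₁ 2)
      (eventually_atTop.2 ⟨2 * n, h1⟩)
  -- fourth moment
  have m4 : ∫ ω, ρ₂ ω * X ω ^ 4 ∂μ ≤ 11 * κ ^ 2 * μ.real s := by
    refine le_of_tendsto (hY.tendsto_integral_pow hX b₂ 4)
      (eventually_atTop.2 ⟨n, fun m hm => ?_⟩)
    have h0 : 0 ≤ ∫ ω, ρ₂ ω ∂μ := integral_nonneg p₂
    have h2 : 0 ≤ ∫ ω, ρ₂ ω * Y n ω ^ 2 ∂μ :=
      integral_nonneg fun ω => mul_nonneg (p₂ ω) (sq_nonneg _)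
    have i4 := (b₂.mul ((hY.bddMeas n hn).pow 4)).integrable (μ := μ) hle
    have i2 := (b₂.mul ((hY.bddMeas n hn).pow 2)).integrable (μ := μ) hle
    have i0 := b₂.integrable (μ := μ) hle
    have i20 : Integrable (fun ω => 8 * (ρ₂ ω * Y n ω ^ 2) + 11 * (K * (n : ℝ)⁻¹) * ρ₂ ω) μ :=
      (i2.const_mul 8).add (i0.const_mul _)
    calc _ ≤ _ := hY.integral_mul_fourth_le hK0.le hK hn hm b₂ p₂
      _ ≤ ∫ ω, ρ₂ ω * Y n ω ^ 4 ∂μ + K * (n : ℝ)⁻¹ *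
      (8 * ∫ ω, ρ₂ ω * Y n ω ^ 2 ∂μ + 11 * (K * (n : ℝ)⁻¹) * ∫ ω, ρ₂ ω ∂μ) := by
          gcongr
          have : (0 : ℝ) ≤ (m : ℝ)⁻¹ := by positivity
          linarith
      _ = ∫ ω, (ρ₂ ω * Y n ω ^ 4 + K * (n : ℝ)⁻¹ * (8 * (ρ₂ ω * Y n ω ^ 2) +
            11 * (K * (n : ℝ)⁻¹) * ρ₂ ω)) ∂μ := by
          rw [integral_add i4 (i20.const_mul _),
            integral_const_mul, integral_add (i2.const_mul 8) (i0.const_mul _),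
            integral_const_mul, integral_const_mul]
      _ ≤ ∫ ω, s.indicator (fun _ => 11 * κ ^ 2) ω ∂μ := by
          refine integral_mono (i4.add (i20.const_mul _))
            (((BddMeas.const _).indicator hs).integrable hle) fun ω => ?_
          by_cases hω : ω ∈ s
          · simp only [hρ₂, Set.indicator_of_mem hω]
            have h5 : Y n ω ^ 4 + K * (n : ℝ)⁻¹ * (8 * Y n ω ^ 2 + 11 * (K * (n : ℝ)⁻¹)) ≤
                11 * q ω ^ 2 := by
              rw [hq]
              nlinarith [mul_nonneg hKn.le (sq_nonneg (Y n ω)), sq_nonneg (Y n ω ^ 2)]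
            calc _ = (κ * (q ω)⁻¹) ^ 2 * (Y n ω ^ 4 + K * (n : ℝ)⁻¹ *
                  (8 * Y n ω ^ 2 + 11 * (K * (n : ℝ)⁻¹))) := by ring
              _ ≤ (κ * (q ω)⁻¹) ^ 2 * (11 * q ω ^ 2) := by gcongr
              _ = 11 * κ ^ 2 := by have := (hq0 ω).ne'; field_simp
          · simp [hρ₂, hω]
      _ = 11 * κ ^ 2 * μ.real s := by
          rw [integral_indicator hs', setIntegral_const]; simp [mul_comm]
  have hbound : 2 * ∫ ω, ρ₁ ω * X ω ^ 2 ∂μ - ∫ ω, ρ₂ ω * X ω ^ 4 ∂μ ≤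
      μ.real (s ∩ {ω | X ω ≠ 0}) := by
    have i₁ := hY.integrable_mul_limit_pow hXm hX b₁ 2
    have i₂ := hY.integrable_mul_limit_pow hXm hX b₂ 4
    rw [← integral_const_mul, ← integral_sub (i₁.const_mul 2) i₂,
      ← integral_indicator_one (hs'.inter hE')]
    refine integral_mono ((i₁.const_mul 2).sub i₂)
      ((integrable_const (1 : ℝ)).indicator (hs'.inter hE')) fun ω => ?_
    by_cases hω : ω ∈ s
    · by_cases hx : X ω = 0
      · simp [hx]
      · have : ω ∈ s ∩ {ω | X ω ≠ 0} := ⟨hω, hx⟩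
        simp only [hρ₁, hρ₂, Set.indicator_of_mem hω, Set.indicator_of_mem this, Pi.one_apply]
        nlinarith [sq_nonneg (κ * (q ω)⁻¹ * X ω ^ 2 - 1)]
    · have : ω ∉ s ∩ {ω | X ω ≠ 0} := fun h => hω h.1
      simp [hρ₁, hρ₂, hω]
  have hfin : θ ^ 2 / 11 * μ.real s = 2 * (θ * κ * μ.real s) - 11 * κ ^ 2 * μ.real s := by
    rw [hκ]; ring
  rw [hfin]
  linarith

end IsAveraging

end URRT

/-! ### Adapted tree functionals and linear growth of subtrees -/

namespace URRT

open Finset MeasureTheory ProbabilityTheory Filter Topology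

variable {Ω : Type*} [MeasurableSpace Ω] {μ : Measure Ω} {A : ℕ → Ω → ℕ}

theorem bddMeas_history (hA : IsUniformAttachment μ A) {n : ℕ} {f : (ℕ → ℕ) → ℝ} {C : ℝ}
    (hf : ∀ a b : ℕ → ℕ, (∀ k, 1 ≤ k → k < n → a k = b k) → f a = f b) (hC : ∀ a, |f a| ≤ C) :
    BddMeas (history hA n) fun ω => f fun k => A k ω :=
  ⟨measurable_history hA hf, C, fun _ => hC _⟩

theorem bddMeas_subtreeSize (hA : IsUniformAttachment μ A) {w n : ℕ} (hw : 1 ≤ w) :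
    BddMeas (history hA n) fun ω => (subtreeSize (fun k => A k ω) w n : ℝ) :=
  bddMeas_history hA (f := fun a => (subtreeSize a w n : ℝ)) (C := n)
    (fun a b h => by rw [subtreeSize_congr hw h]) fun a => by
      rw [abs_of_nonneg (by positivity)]; exact_mod_cast subtreeSize_le a w n

theorem bddMeas_desc (hA : IsUniformAttachment μ A) {w n i : ℕ} (hw : 1 ≤ w) (hi : i ≤ n) :
    BddMeas (history hA n) fun ω => if anc (fun k => A k ω) w i = w then (1 : ℝ) else 0 :=
  bddMeas_history hA (f := fun a => if anc a w i = w then (1 : ℝ) else 0) (C := 1)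
    (fun a b h => by rw [anc_congr hw h i hi]) fun a => by split_ifs <;> simp

/-- The relation `E a` on `[n]` is determined by the tree on `[n]`. -/
def IsLocalRel (E : (ℕ → ℕ) → ℕ → ℕ → Prop) : Prop :=
  ∀ n (a b : ℕ → ℕ), (∀ k, 1 ≤ k → k < n → a k = b k) →
    ∀ i ∈ Icc 1 n, ∀ t ∈ Icc 1 n, (E a i t ↔ E b i t)

theorem bddMeas_pairCount (hA : IsUniformAttachment μ A) {E : (ℕ → ℕ) → ℕ → ℕ → Prop}
    (hE : IsLocalRel E) (n : ℕ) :
    BddMeas (history hA n) fun ω => (pairCount (E fun k => A k ω) n : ℝ) :=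
  bddMeas_history hA (f := fun a => (pairCount (E a) n : ℝ)) (C := n * n)
    (fun a b h => by rw [pairCount_congr (hE n a b h)]) fun a => by
      rw [abs_of_nonneg (by positivity)]; exact_mod_cast pairCount_le (E a) n

theorem bddMeas_row (hA : IsUniformAttachment μ A) {E : (ℕ → ℕ) → ℕ → ℕ → Prop}
    (hE : IsLocalRel E) {n i : ℕ} (hi : i ∈ Icc 1 n) :
    BddMeas (history hA n) fun ω => (row (E fun k => A k ω) n i : ℝ) :=
  bddMeas_history hA (f := fun a => (row (E a) n i : ℝ)) (C := n)
    (fun a b h => by rw [row_congr (hE n a b h i hi)]) fun a => by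
      rw [abs_of_nonneg (by positivity)]; exact_mod_cast row_le (E a) n i

/-! ### Proportions of subtrees -/

/-- A Pólya urn: `n + 1` joins the subtree exactly when its parent belongs to it. -/
theorem isAveraging_subtreeSize [IsProbabilityMeasure μ] (hA : IsUniformAttachment μ A) {w : ℕ}
    (hw : 1 ≤ w) :
    IsAveraging hA w (fun n ω => (n : ℝ)⁻¹ * subtreeSize (fun k => A k ω) w n)
      (fun n i ω => (n + 1 : ℝ)⁻¹ * (subtreeSize (fun k => A k ω) w n +
        if anc (fun k => A k ω) w i = w then (1 : ℝ) else 0)) where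
  one_le := hw
  bddMeas m _ := (BddMeas.const _).mul (bddMeas_subtreeSize hA hw)
  bddMeas_step m _ i hi := (BddMeas.const _).mul
    ((bddMeas_subtreeSize hA hw).add (bddMeas_desc hA hw (mem_Icc.1 hi).2))
  bdd := by
    refine ⟨1, fun m hm ω => ?_⟩
    have hm0 : (0 : ℝ) < m := by norm_cast; omega
    rw [abs_of_nonneg (by positivity), inv_mul_le_one₀ hm0]
    exact_mod_cast subtreeSize_le _ w m
  step m hm := by
    filter_upwards [hA.ae_isAttachment] with ω ha
    rw [subtreeSize_succ ha hw hm]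
    push_cast
    rfl
  sum_eq m hm ω := by
    have hm0 : (m : ℝ) ≠ 0 := by norm_cast; omega
    have hm1 : (m + 1 : ℝ) ≠ 0 := by positivity
    have : ∑ i ∈ Icc 1 m, (if anc (fun k => A k ω) w i = w then (1 : ℝ) else 0) =
        subtreeSize (fun k => A k ω) w m := by simp [subtreeSize]
    rw [← mul_sum, sum_add_distrib, this]
    simp only [sum_const, Nat.card_Icc, Nat.add_sub_cancel, nsmul_eq_mul]
    field_simp

/-- The rising factorial `S (S + 1)` is multiplied on average by `(n + 2) / n`. It gives the second
moment of the urn limit. -/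
theorem isAveraging_subtreeSize_sq [IsProbabilityMeasure μ] (hA : IsUniformAttachment μ A)
    {w : ℕ} (hw : 1 ≤ w) :
    IsAveraging hA w
      (fun n ω => (n * (n + 1) : ℝ)⁻¹ * ((subtreeSize (fun k => A k ω) w n : ℝ) *
        (subtreeSize (fun k => A k ω) w n + 1)))
      (fun n i ω => ((n + 1) * (n + 2) : ℝ)⁻¹ * ((subtreeSize (fun k => A k ω) w n +
        if anc (fun k => A k ω) w i = w then (1 : ℝ) else 0) * ((subtreeSize (fun k => A k ω) w n +
        if anc (fun k => A k ω) w i = w then (1 : ℝ) else 0) + 1))) where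
  one_le := hw
  bddMeas m _ := (BddMeas.const _).mul
    ((bddMeas_subtreeSize hA hw).mul ((bddMeas_subtreeSize hA hw).add (BddMeas.const 1)))
  bddMeas_step m _ i hi := by
    have h := (bddMeas_subtreeSize hA (n := m) hw).add (bddMeas_desc hA hw (mem_Icc.1 hi).2)
    exact (BddMeas.const _).mul (h.mul (h.add (BddMeas.const 1)))
  bdd := by
    refine ⟨1, fun m hm ω => ?_⟩
    have hm0 : (0 : ℝ) < m := by norm_cast; omega
    rw [abs_of_nonneg (by positivity), inv_mul_le_one₀ (by positivity)]
    have : (subtreeSize (fun k => A k ω) w m : ℝ) ≤ m := by exact_mod_cast subtreeSize_le _ w m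
    gcongr
  step m hm := by
    filter_upwards [hA.ae_isAttachment] with ω ha
    rw [subtreeSize_succ ha hw hm]
    push_cast
    ring
  sum_eq m hm ω := by
    have hm0 : (m : ℝ) ≠ 0 := by norm_cast; omega
    have h : ∀ i, ((subtreeSize (fun k => A k ω) w m +
        if anc (fun k => A k ω) w i = w then (1 : ℝ) else 0) * ((subtreeSize (fun k => A k ω) w m +
        if anc (fun k => A k ω) w i = w then (1 : ℝ) else 0) + 1)) =
        (subtreeSize (fun k => A k ω) w m : ℝ) * (subtreeSize (fun k => A k ω) w m + 1) +
        2 * (subtreeSize (fun k => A k ω) w m + 1) *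
          if anc (fun k => A k ω) w i = w then (1 : ℝ) else 0 := by
      intro i; split_ifs <;> ring
    have : ∑ i ∈ Icc 1 m, (if anc (fun k => A k ω) w i = w then (1 : ℝ) else 0) =
        subtreeSize (fun k => A k ω) w m := by simp [subtreeSize]
    rw [← mul_sum, sum_congr rfl fun i _ => h i, sum_add_distrib, sum_const,
      ← mul_sum, this]
    simp only [Nat.card_Icc, Nat.add_sub_cancel, nsmul_eq_mul]
    field_simp

/-- Every subtree asymptotically occupies a positive proportion of the tree. -/
theorem ae_exists_subtreeSize_ge [IsProbabilityMeasure μ] (hA : IsUniformAttachment μ A) {w : ℕ}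
    (hw : 1 ≤ w) :
    ∀ᵐ ω ∂μ, ∃ c : ℝ, 0 < c ∧ ∀ᶠ n : ℕ in atTop, c * n ≤ subtreeSize (fun k => A k ω) w n := by
  have h₁ := isAveraging_subtreeSize hA hw
  have h₂ := isAveraging_subtreeSize_sq hA hw
  obtain ⟨X, hXm, hX⟩ := h₁.exists_tendsto
  have hX2 : ∀ᵐ ω ∂μ, Tendsto (fun n : ℕ => (n * (n + 1) : ℝ)⁻¹ *
      ((subtreeSize (fun k => A k ω) w n : ℝ) * (subtreeSize (fun k => A k ω) w n + 1)))
      atTop (𝓝 (X ω ^ 2)) := by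
    filter_upwards [hX] with ω hω
    have l1 : Tendsto (fun n : ℕ => (1 : ℝ) / (n + 1)) atTop (𝓝 0) :=
      tendsto_one_div_add_atTop_nhds_zero_nat
    have l2 := (hω.mul (hω.mul ((tendsto_const_nhds (x := (1 : ℝ))).sub l1))).add (hω.mul l1)
    have e : X ω * (X ω * (1 - 0)) + X ω * 0 = X ω ^ 2 := by ring
    rw [e] at l2
    refine l2.congr' ?_
    filter_upwards [eventually_ge_atTop 1] with n hn
    have : (n : ℝ) ≠ 0 := by norm_cast; omega
    field_simp
    ring
  have hE : MeasurableSet[⨆ n, history hA n] {ω | X ω ≠ 0} :=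
    (hXm (measurableSet_singleton 0)).compl
  have hE' : MeasurableSet {ω | X ω ≠ 0} :=
    (iSup_le fun n => (history hA).le n : ⨆ n, history hA n ≤ _) _ hE
  have hXm2 : Measurable[⨆ n, history hA n] fun ω => X ω ^ 2 := hXm.pow_const 2
  have key : ∀ᵐ ω ∂μ, (∃ᶠ n in atTop, ω ∈ (if w ≤ n then Set.univ else ∅ : Set Ω)) →
      ω ∈ {ω | X ω ≠ 0} := by
    -- Given the tree on `[n]`, `X` has mean `S / n` and `X^2` mean at most `2 (S / n)^2`.
    -- Integrating `1_{X ≠ 0} ≥ 2τX - τ^2X^2` with `τ = n / (2S)` gives `1 - 1 / 2`.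
    refine ae_mem_of_frequently_mem hE (G := fun n => if w ≤ n then Set.univ else ∅)
      (fun n => by split_ifs <;> simp) (δ := 1 / 2) (by norm_num) fun n s hs hsG => ?_
    by_cases hn : w ≤ n
    swap
    · rw [if_neg hn, Set.subset_empty_iff] at hsG
      simp [hsG]
    have hs' : MeasurableSet s := (history hA).le n s hs
    have hle := (history hA).le n
    have hn0 : (0 : ℝ) < n := by norm_cast; omega
    obtain ⟨S, hS⟩ : ∃ S : Ω → ℝ, S = fun ω => (subtreeSize (fun k => A k ω) w n : ℝ) := ⟨_, rfl⟩
    have hS1 : ∀ ω, 1 ≤ S ω := fun ω => by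
      simp only [hS]; exact_mod_cast subtreeSize_pos _ hw hn
    have hSm : BddMeas (history hA n) S := by rw [hS]; exact bddMeas_subtreeSize hA hw
    have hSi : BddMeas (history hA n) fun ω => (S ω)⁻¹ := by
      refine ⟨hSm.1.inv, 1, fun ω => ?_⟩
      rw [abs_of_pos (inv_pos.2 (one_pos.trans_le (hS1 ω)))]
      exact inv_le_one_of_one_le₀ (hS1 ω)
    obtain ⟨ρ₁, hρ₁⟩ : ∃ ρ : Ω → ℝ, ρ = s.indicator fun ω => n / 2 * (S ω)⁻¹ := ⟨_, rfl⟩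
    obtain ⟨ρ₂, hρ₂⟩ : ∃ ρ : Ω → ℝ, ρ = s.indicator fun ω => (n / 2 * (S ω)⁻¹) ^ 2 := ⟨_, rfl⟩
    have b₁ : BddMeas (history hA n) ρ₁ := by
      rw [hρ₁]; exact ((BddMeas.const _).mul hSi).indicator hs
    have b₂ : BddMeas (history hA n) ρ₂ := by
      rw [hρ₂]; exact (((BddMeas.const _).mul hSi).pow 2).indicator hs
    have m1 : ∫ ω, ρ₁ ω * X ω ^ 1 ∂μ = 1 / 2 * μ.real s := by
      refine tendsto_nhds_unique (h₁.tendsto_integral_pow hX b₁ 1)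
        (tendsto_const_nhds.congr' ?_)
      filter_upwards [eventually_ge_atTop n] with m hm
      simp only [pow_one]
      rw [h₁.integral_mul_eq hn hm b₁]
      have e2 : 1 / 2 * μ.real s = ∫ ω, s.indicator (fun _ => (1 / 2 : ℝ)) ω ∂μ := by
        rw [integral_indicator hs', setIntegral_const]; simp [mul_comm]
      rw [e2]
      congr 1
      ext ω
      by_cases hω : ω ∈ s
      · have := (one_pos.trans_le (hS1 ω)).ne'
        rw [hS] at this
        simp only [hρ₁, Set.indicator_of_mem hω, hS]
        field_simp
      · simp [hρ₁, hω]
    have m2 : ∫ ω, ρ₂ ω * (X ω ^ 2) ^ 1 ∂μ ≤ 1 / 2 * μ.real s := by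
      refine le_of_tendsto (h₂.tendsto_integral_pow hX2 b₂ 1) ?_
      filter_upwards [eventually_ge_atTop n] with m hm
      simp only [pow_one]
      rw [h₂.integral_mul_eq hn hm b₂]
      have e2 : 1 / 2 * μ.real s = ∫ ω, s.indicator (fun _ => (1 / 2 : ℝ)) ω ∂μ := by
        rw [integral_indicator hs', setIntegral_const]; simp [mul_comm]
      rw [e2]
      refine integral_mono ((b₂.mul (h₂.bddMeas n hn)).integrable hle)
        (((BddMeas.const _).indicator hs).integrable hle) fun ω => ?_
      by_cases hω : ω ∈ s
      · have h1 := hS1 ω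
        have h0 := one_pos.trans_le h1
        have e3 : (subtreeSize (fun k => A k ω) w n : ℝ) = S ω := by rw [hS]
        simp only [hρ₂, Set.indicator_of_mem hω, e3]
        have : (n / 2 * (S ω)⁻¹) ^ 2 * ((n * (n + 1) : ℝ)⁻¹ * (S ω * (S ω + 1))) =
            (n * (S ω + 1)) / (4 * ((n + 1) * S ω)) := by field_simp; norm_num
        rw [this, div_le_div_iff₀ (by positivity) (by norm_num)]
        nlinarith
      · simp [hρ₂, hω]
    have i₁ := h₁.integrable_mul_limit_pow hXm hX b₁ 1
    have i₂ := h₂.integrable_mul_limit_pow hXm2 hX2 b₂ 1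
    have hbound : 2 * ∫ ω, ρ₁ ω * X ω ^ 1 ∂μ - ∫ ω, ρ₂ ω * (X ω ^ 2) ^ 1 ∂μ ≤
        μ.real (s ∩ {ω | X ω ≠ 0}) := by
      rw [← integral_const_mul, ← integral_sub (i₁.const_mul 2) i₂,
        ← integral_indicator_one (hs'.inter hE')]
      refine integral_mono ((i₁.const_mul 2).sub i₂)
        ((integrable_const (1 : ℝ)).indicator (hs'.inter hE')) fun ω => ?_
      by_cases hω : ω ∈ s
      · by_cases hx : X ω = 0
        · simp [hx]
        · have : ω ∈ s ∩ {ω | X ω ≠ 0} := ⟨hω, hx⟩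
          simp only [hρ₁, hρ₂, Set.indicator_of_mem hω, Set.indicator_of_mem this, Pi.one_apply]
          nlinarith [sq_nonneg (n / 2 * (S ω)⁻¹ * X ω - 1)]
      · have : ω ∉ s ∩ {ω | X ω ≠ 0} := fun h => hω h.1
        simp [hρ₁, hρ₂, hω]
    linarith
  filter_upwards [key, hX] with ω h1 h2
  have h3 : X ω ≠ 0 := h1 (by
    refine Eventually.frequently ?_
    filter_upwards [eventually_ge_atTop w] with n hn
    simp [hn])
  have h4 : 0 < X ω := lt_of_le_of_ne (ge_of_tendsto h2 (Eventually.of_forall fun n => by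
    positivity)) h3.symm
  refine ⟨X ω / 2, by positivity, ?_⟩
  filter_upwards [h2.eventually_const_le (half_lt_self h4), eventually_ge_atTop 1] with n hn hn1
  have : (0 : ℝ) < n := by norm_cast
  rwa [← le_inv_mul_iff₀' this] at *

end URRT

/-! ### Pair densities: small subtrees of large labels, comparison of two vertices -/

namespace URRT

open Finset MeasureTheory ProbabilityTheory Filter Topology

variable {Ω : Type*} [MeasurableSpace Ω] {μ : Measure Ω} {A : ℕ → Ω → ℕ}

theorem measurableSet_history (hA : IsUniformAttachment μ A) {n : ℕ} {p : (ℕ → ℕ) → Prop}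
    (hp : ∀ a b : ℕ → ℕ, (∀ k, 1 ≤ k → k < n → a k = b k) → (p a ↔ p b)) :
    MeasurableSet[history hA n] {ω | p fun k => A k ω} := by
  have h := measurable_history hA (f := p) (fun a b hab => propext (hp a b hab))
    (measurableSet_singleton True)
  convert h using 1
  ext ω
  simp

theorem IsAveraging.mono {hA : IsUniformAttachment μ A} {n₀ n₁ : ℕ} {Y : ℕ → Ω → ℝ}
    {y : ℕ → ℕ → Ω → ℝ} (hY : IsAveraging hA n₀ Y y) (h : n₀ ≤ n₁) : IsAveraging hA n₁ Y y where
  one_le := hY.one_le.trans h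
  bddMeas m hm := hY.bddMeas m (h.trans hm)
  bddMeas_step m hm := hY.bddMeas_step m (h.trans hm)
  bdd := hY.bdd.imp fun _ hC m hm => hC m (h.trans hm)
  step m hm := hY.step m (h.trans hm)
  sum_eq m hm := hY.sum_eq m (h.trans hm)

theorem IsAveraging.sub {hA : IsUniformAttachment μ A} {n₀ : ℕ} {Y Y' : ℕ → Ω → ℝ}
    {y y' : ℕ → ℕ → Ω → ℝ} (hY : IsAveraging hA n₀ Y y) (hY' : IsAveraging hA n₀ Y' y') :
    IsAveraging hA n₀ (fun n ω => Y n ω - Y' n ω) (fun n i ω => y n i ω - y' n i ω) where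
  one_le := hY.one_le
  bddMeas m hm := (hY.bddMeas m hm).sub (hY'.bddMeas m hm)
  bddMeas_step m hm i hi := (hY.bddMeas_step m hm i hi).sub (hY'.bddMeas_step m hm i hi)
  bdd := by
    obtain ⟨C, hC⟩ := hY.bdd
    obtain ⟨D, hD⟩ := hY'.bdd
    exact ⟨C + D, fun m hm ω => (abs_sub _ _).trans (add_le_add (hC m hm ω) (hD m hm ω))⟩
  step m hm := by
    filter_upwards [hY.step m hm, hY'.step m hm] with ω h h'
    rw [h, h']
  sum_eq m hm ω := by rw [sum_sub_distrib, hY.sum_eq m hm, hY'.sum_eq m hm, mul_sub]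

/-- The normalized number of related pairs. -/
noncomputable def pairDensity (E : ℕ → ℕ → Prop) (n : ℕ) : ℝ :=
  (n * (n + 1) : ℝ)⁻¹ * (pairCount E n + n)

/-- The normalized number of related pairs after attaching `n + 1` to `i`. -/
noncomputable def pairDensityStep (E : ℕ → ℕ → Prop) (n i : ℕ) : ℝ :=
  ((n + 1) * (n + 2) : ℝ)⁻¹ * (pairCount E n + 2 * row E n i + (n + 2))

/-- The rows sum to the pair count `P`, so `P + n` becomes `(P + n)(n + 2) / n` on average; the
shift by `n` absorbs the diagonal pairs. -/
theorem isAveraging_pairDensity [IsProbabilityMeasure μ] (hA : IsUniformAttachment μ A) {E :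
    (ℕ → ℕ) → ℕ → ℕ → Prop}
    (hE : IsLocalRel E) {n₀ : ℕ} (hn₀ : 1 ≤ n₀)
    (hsucc : ∀ a, IsAttachment a → ∀ n, n₀ ≤ n →
      pairCount (E a) (n + 1) = pairCount (E a) n + 2 * row (E a) n (a n) + 1) :
    IsAveraging hA n₀ (fun n ω => pairDensity (E fun k => A k ω) n)
      (fun n i ω => pairDensityStep (E fun k => A k ω) n i) where
  one_le := hn₀
  bddMeas m _ := (BddMeas.const _).mul ((bddMeas_pairCount hA hE m).add (BddMeas.const _))
  bddMeas_step m _ i hi := (BddMeas.const _).mul (((bddMeas_pairCount hA hE m).add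
    ((BddMeas.const 2).mul (bddMeas_row hA hE hi))).add (BddMeas.const _))
  bdd := by
    refine ⟨1, fun m hm ω => ?_⟩
    have hm0 : (0 : ℝ) < m := by norm_cast; omega
    have h : (pairCount (E fun k => A k ω) m : ℝ) ≤ m * m := by
      exact_mod_cast pairCount_le _ m
    unfold pairDensity
    rw [abs_of_nonneg (by positivity), inv_mul_le_one₀ (by positivity)]
    linarith
  step m hm := by
    filter_upwards [hA.ae_isAttachment] with ω ha
    rw [pairDensity, pairDensityStep, hsucc _ ha m hm]
    push_cast
    ring
  sum_eq m hm ω := by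
    have hm0 : (m : ℝ) ≠ 0 := by norm_cast; omega
    have h : ∑ i ∈ Icc 1 m, (row (E fun k => A k ω) m i : ℝ) = pairCount (E fun k => A k ω) m := by
      unfold pairCount; push_cast; rfl
    simp only [pairDensityStep, pairDensity]
    rw [← mul_sum, sum_add_distrib, sum_add_distrib, ← mul_sum, h, sum_const, sum_const]
    simp only [Nat.card_Icc, Nat.add_sub_cancel, nsmul_eq_mul]
    field_simp

theorem isAveraging_sameAnc [IsProbabilityMeasure μ] (hA : IsUniformAttachment μ A) {M : ℕ}
    (hM : 1 ≤ M) :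
    IsAveraging hA M (fun n ω => pairDensity (SameAnc (fun k => A k ω) M) n)
      (fun n i ω => pairDensityStep (SameAnc (fun k => A k ω) M) n i) :=
  isAveraging_pairDensity hA (E := fun a => SameAnc a M) (fun _ _ _ h => sameAnc_congr hM h) hM
    fun _ ha _ hn => pairCount_sameAnc_succ ha hM hn

theorem isAveraging_sameBranch [IsProbabilityMeasure μ] (hA : IsUniformAttachment μ A) {v : ℕ}
    (hv : 1 ≤ v) :
    IsAveraging hA v (fun n ω => pairDensity (SameBranch (fun k => A k ω) v) n)
      (fun n i ω => pairDensityStep (SameBranch (fun k => A k ω) v) n i) :=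
  isAveraging_pairDensity hA (E := fun a => SameBranch a v) (fun _ _ _ h => sameBranch_congr hv h)
    hv fun _ ha _ hn => pairCount_sameBranch_succ ha hv hn

/-! ### Vertices with large labels -/

/-- The density starts at `2 / (M + 1)` when the tree is `[M]`, and its mean is preserved. By
Markov's inequality the limits for all `M` cannot simultaneously be at least `δ` with positive
probability. -/
theorem ae_exists_limit_sameAnc_lt [IsProbabilityMeasure μ] (hA : IsUniformAttachment μ A)
    {δ : ℝ} (hδ : 0 < δ) :
    ∀ᵐ ω ∂μ, ∃ M, 1 ≤ M ∧ ∀ᶠ n in atTop, pairDensity (SameAnc (fun k => A k ω) M) n < δ := by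
  have h : ∀ M : ℕ, ∃ X : Ω → ℝ, Measurable X ∧ (∀ᵐ ω ∂μ, Tendsto
      (fun n => pairDensity (SameAnc (fun k => A k ω) (M + 1)) n) atTop (𝓝 (X ω))) ∧
      δ * μ.real {ω | δ ≤ X ω} ≤ 2 / ((M : ℝ) + 2) := by
    intro M
    have hY := isAveraging_sameAnc hA (M := M + 1) (by omega)
    obtain ⟨X, hXm, hX⟩ := hY.exists_tendsto
    refine ⟨X, hXm.mono (iSup_le fun n => (history hA).le n) le_rfl, hX, ?_⟩
    have b : BddMeas (history hA (M + 1)) fun _ => (1 : ℝ) := BddMeas.const 1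
    have hint : ∫ ω, X ω ∂μ = 2 / ((M : ℝ) + 2) := by
      have h1 := hY.tendsto_integral_pow hX b 1
      simp only [one_mul, pow_one] at h1
      refine tendsto_nhds_unique h1 (tendsto_const_nhds.congr' ?_)
      filter_upwards [eventually_ge_atTop (M + 1)] with m hm
      have h2 := hY.integral_mul_eq le_rfl hm b
      simp only [one_mul] at h2
      rw [h2]
      simp only [pairDensity, pairCount_sameAnc_self, integral_const, probReal_univ, one_smul]
      push_cast
      field_simp
      ring
    have hXint : Integrable X μ := by
      simpa using hY.integrable_mul_limit_pow hXm hX b 1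
    rw [← hint]
    refine mul_meas_ge_le_integral_of_nonneg ?_ hXint δ
    filter_upwards [hX] with ω hω
    refine ge_of_tendsto hω (Eventually.of_forall fun n => ?_)
    unfold pairDensity
    positivity
  choose X hXm hX hXδ using h
  have hzero : μ.real (⋂ M, {ω | δ ≤ X M ω}) = 0 := by
    refine le_antisymm ?_ measureReal_nonneg
    have h1 : ∀ M : ℕ, δ * μ.real (⋂ M, {ω | δ ≤ X M ω}) ≤ 2 / ((M : ℝ) + 2) := fun M =>
      (mul_le_mul_of_nonneg_left (measureReal_mono (Set.iInter_subset _ M)) hδ.le).trans (hXδ M)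
    have h2 : Tendsto (fun M : ℕ => (2 : ℝ) / ((M : ℝ) + 2)) atTop (𝓝 0) :=
      tendsto_const_nhds.div_atTop
        (tendsto_atTop_add_const_right _ _ tendsto_natCast_atTop_atTop)
    have h3 := ge_of_tendsto' h2 h1
    by_contra h4
    exact absurd (mul_pos hδ (not_le.1 h4)) (not_lt.2 h3)
  rw [measureReal_eq_zero_iff] at hzero
  have hne : ∀ᵐ ω ∂μ, ω ∉ ⋂ M, {ω | δ ≤ X M ω} := measure_eq_zero_iff_ae_notMem.1 hzero
  filter_upwards [hne, ae_all_iff.2 hX] with ω h1 h2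
  rw [Set.mem_iInter, not_forall] at h1
  obtain ⟨M, hM⟩ := h1
  exact ⟨M + 1, by omega, (h2 M).eventually_lt_const (not_le.1 hM)⟩

/-- Vertices with large labels have uniformly small subtrees. -/
theorem ae_exists_subtreeSize_le [IsProbabilityMeasure μ] (hA : IsUniformAttachment μ A) :
    ∀ᵐ ω ∂μ, ∀ ε : ℝ, 0 < ε → ∃ M, 1 ≤ M ∧ ∀ᶠ n : ℕ in atTop, ∀ w, M ≤ w →
      (subtreeSize (fun k => A k ω) w n : ℝ) ≤ ε * n := by
  have h := ae_all_iff.2 fun k : ℕ =>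
    ae_exists_limit_sameAnc_lt hA (δ := 1 / ((k : ℝ) + 1)) (by positivity)
  filter_upwards [h, hA.ae_isAttachment] with ω hω ha ε hε
  -- The factor `1 / 2` pays for `n (n + 1) ≤ 2n^2`, so that the squared subtree size is at most
  -- `ε^2 n^2`.
  obtain ⟨k, hk⟩ := exists_nat_one_div_lt (show 0 < ε ^ 2 / 2 by positivity)
  obtain ⟨M, hM, hn⟩ := hω k
  refine ⟨M, hM, ?_⟩
  filter_upwards [hn, eventually_ge_atTop 1] with n hn hn1 w hw
  have hn0 : (1 : ℝ) ≤ n := by exact_mod_cast hn1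
  have h1 : (subtreeSize (fun k => A k ω) w n : ℝ) * subtreeSize (fun k => A k ω) w n ≤
      pairCount (SameAnc (fun k => A k ω) M) n := by exact_mod_cast subtreeSize_sq_le ha hM hw
  have h2 := hn.trans hk
  rw [pairDensity, inv_mul_lt_iff₀ (by positivity)] at h2
  refine abs_le_of_sq_le_sq' ?_ (by positivity) |>.2
  have : ε ^ 2 * n ≤ ε ^ 2 * (n * n) := by gcongr; nlinarith
  nlinarith

/-! ### Comparison of two vertices -/

theorem abs_sub_mean_le {s x m : ℝ} (hm : 0 < m) (hs : |s| ≤ m * m) (hx : |x| ≤ m) :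
    (x - s / m) ^ 2 ≤ 4 * m ^ 2 := by
  have h1 : |s / m| ≤ m := by rw [abs_div, abs_of_pos hm, div_le_iff₀ hm]; exact hs
  have h2 : |x - s / m| ≤ 2 * m := (abs_sub _ _).trans (by linarith)
  calc (x - s / m) ^ 2 = |x - s / m| ^ 2 := (sq_abs _).symm
    _ ≤ (2 * m) ^ 2 := by gcongr
    _ = 4 * m ^ 2 := by ring

/-- The difference of the pair counts for `v` and `u`. -/
noncomputable def countDiff (a : ℕ → ℕ) (u v n : ℕ) : ℝ :=
  (pairCount (SameBranch a v) n : ℝ) - pairCount (SameBranch a u) n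

theorem pairDensity_sub (a : ℕ → ℕ) (u v n : ℕ) :
    pairDensity (SameBranch a v) n - pairDensity (SameBranch a u) n =
      (n * (n + 1) : ℝ)⁻¹ * countDiff a u v n := by
  unfold pairDensity countDiff; ring

/-- `countDiff / m` is the mean of `rowDiff` over the attachment vertex, so the martingale increment
is a centred, rescaled `rowDiff`. -/
theorem pairDensityStep_sub_sub (a : ℕ → ℕ) (u v i : ℕ) {m : ℕ} (hm : 1 ≤ m) :
    pairDensityStep (SameBranch a v) m i - pairDensityStep (SameBranch a u) m i -
      (pairDensity (SameBranch a v) m - pairDensity (SameBranch a u) m) =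
      2 * ((m + 1) * (m + 2) : ℝ)⁻¹ * (rowDiff a u v m i - countDiff a u v m / m) := by
  have hm0 : (m : ℝ) ≠ 0 := by norm_cast; omega
  unfold pairDensity pairDensityStep countDiff rowDiff
  field_simp
  ring

theorem smallSteps_pairDensity_sub {Ω : Type*} {A : ℕ → Ω → ℕ} (u v : ℕ) {n₀ : ℕ} (hn₀ : 1 ≤ n₀) :
    IsAveraging.SmallSteps n₀
      (fun n ω => pairDensity (SameBranch (fun k => A k ω) v) n -
        pairDensity (SameBranch (fun k => A k ω) u) n)
      (fun n i ω => pairDensityStep (SameBranch (fun k => A k ω) v) n i -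
        pairDensityStep (SameBranch (fun k => A k ω) u) n i) 16 := by
  intro m hm ω i hi
  have hm0 : (0 : ℝ) < m := by norm_cast; omega
  simp only
  rw [pairDensityStep_sub_sub _ _ _ _ (by omega), mul_pow]
  have h1 : (rowDiff (fun k => A k ω) u v m i - countDiff (fun k => A k ω) u v m / m) ^ 2 ≤
      4 * (m : ℝ) ^ 2 := by
    have b : ∀ E : ℕ → ℕ → Prop, (pairCount E m : ℝ) ≤ m * m := fun E => by
      exact_mod_cast pairCount_le E m
    have r : ∀ E : ℕ → ℕ → Prop, (row E m i : ℝ) ≤ m := fun E => by exact_mod_cast row_le E m i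
    refine abs_sub_mean_le hm0 (abs_sub_le_of_nonneg_of_le ?_ (b _) ?_ (b _))
      (abs_sub_le_of_nonneg_of_le ?_ (r _) ?_ (r _)) <;> positivity
  calc _ ≤ (2 * ((m + 1) * (m + 2) : ℝ)⁻¹) ^ 2 * (4 * (m : ℝ) ^ 2) := by gcongr
    _ = 16 * ((m : ℝ) ^ 2 / ((m + 1) * (m + 2)) ^ 2) := by field_simp; norm_num
    _ ≤ 16 * (1 / (m * (m + 1))) := by
        refine mul_le_mul_of_nonneg_left ?_ (by positivity)
        rw [div_le_div_iff₀ (by positivity) (by positivity)]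
        nlinarith [pow_pos hm0 2, pow_pos hm0 3]
    _ = _ := by field_simp; norm_num

/-- Subtrees only grow, so for `k < 2n` they still have at least `ck / 2` vertices, and
`le_sum_sq_rowDiff` applies with `r = ck / 2` and `z` the mean. The constant is `72 = 4 * 18`, with
`18` from `(k + 1)(k + 2)^2 ≤ 18k^3`. -/
theorem le_stepVar_pairDensity_sub {Ω : Type*} {A : ℕ → Ω → ℕ} {u v w₁ w₂ j n k : ℕ} {c : ℝ}
    (hc : 0 < c) {ω : Ω}
    (ha : IsAttachment fun k => A k ω) (hu : 1 ≤ u) (huv : u < v) (h₁ : v ≤ w₁) (h₂ : v ≤ w₂)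
    (hj : v ≤ j) (hne : w₁ ≠ w₂) (hw₁ : A w₁ ω = v) (hw₂ : A w₂ ω = v) (haj : A j ω = u)
    (hS₁ : c * n ≤ subtreeSize (fun k => A k ω) (w₁ + 1) n)
    (hS₂ : c * n ≤ subtreeSize (fun k => A k ω) (w₂ + 1) n)
    (hSj : c * n ≤ subtreeSize (fun k => A k ω) (j + 1) n) (hnk : n ≤ k) (hk : k < 2 * n) :
    c ^ 3 / 72 * ((k : ℝ)⁻¹ - (k + 1 : ℝ)⁻¹) ≤ IsAveraging.stepVar
      (fun n ω => pairDensity (SameBranch (fun k => A k ω) v) n -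
        pairDensity (SameBranch (fun k => A k ω) u) n)
      (fun n i ω => pairDensityStep (SameBranch (fun k => A k ω) v) n i -
        pairDensityStep (SameBranch (fun k => A k ω) u) n i) k ω := by
  have hk1 : (1 : ℝ) ≤ k := by norm_cast; omega
  have hk0 : (0 : ℝ) < k := by linarith
  have hkn : (k : ℝ) ≤ 2 * n := by exact_mod_cast hk.le
  have hmono : ∀ w, c * n ≤ subtreeSize (fun k => A k ω) w n →
      c * (k / 2) ≤ subtreeSize (fun k => A k ω) w k := by
    intro w h
    have h1 : (subtreeSize (fun k => A k ω) w n : ℝ) ≤ subtreeSize (fun k => A k ω) w k := by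
      exact_mod_cast subtreeSize_mono _ w hnk
    have h2 : c * (k / 2) ≤ c * n := by gcongr; linarith
    linarith
  have h := le_sum_sq_rowDiff ha (r := c * (k / 2)) (z := countDiff (fun k => A k ω) u v k / k)
    (by positivity) hu huv h₁ h₂ hj hw₁ hw₂ haj hne (hmono _ hS₁) (hmono _ hS₂) (hmono _ hSj)
  unfold IsAveraging.stepVar
  simp only [pairDensityStep_sub_sub _ _ _ _ (show 1 ≤ k by omega), mul_pow]
  rw [← mul_sum]
  calc _ = c ^ 3 / 72 * (1 / (k * (k + 1))) := by field_simp; norm_num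
    _ ≤ c ^ 3 / 72 * (18 * (k : ℝ) ^ 2 / ((k + 1) * (k + 2)) ^ 2) := by
        refine mul_le_mul_of_nonneg_left ?_ (by positivity)
        rw [div_le_div_iff₀ (by positivity) (by positivity)]
        have : ((k : ℝ) + 1) * (k + 2) ^ 2 ≤ 18 * k ^ 3 := by
          have e1 : (k : ℝ) + 1 ≤ 2 * k := by linarith
          have e2 : (k : ℝ) + 2 ≤ 3 * k := by linarith
          calc ((k : ℝ) + 1) * (k + 2) ^ 2 ≤ (2 * k) * (3 * k) ^ 2 := by gcongr
            _ = _ := by ring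
        calc (1 : ℝ) * (((k : ℝ) + 1) * (k + 2)) ^ 2 = (k + 1) * (((k : ℝ) + 1) * (k + 2) ^ 2) := by
              ring
          _ ≤ ((k : ℝ) + 1) * (18 * k ^ 3) := by gcongr
          _ = _ := by ring
    _ = (k : ℝ)⁻¹ * ((2 * ((k + 1) * (k + 2) : ℝ)⁻¹) ^ 2 * ((c * (k / 2)) ^ 3 / 2)) := by
        field_simp; norm_num
    _ ≤ _ := by rw [← mul_pow]; gcongr

theorem eventually_lt_or_of_limit_ne_zero {a : ℕ → ℕ} {u v : ℕ} {x : ℝ}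
    (h : Tendsto (fun n => pairDensity (SameBranch a v) n - pairDensity (SameBranch a u) n) atTop
      (𝓝 x)) (hx : x ≠ 0) :
    (∀ᶠ n in atTop, pairCount (SameBranch a v) n < pairCount (SameBranch a u) n) ∨
      ∀ᶠ n in atTop, pairCount (SameBranch a u) n < pairCount (SameBranch a v) n := by
  simp only [pairDensity_sub, countDiff] at h
  rcases hx.lt_or_gt with hx | hx
  · left
    filter_upwards [h.eventually_lt_const hx] with n hn
    have h1 := neg_of_mul_neg_right hn (by positivity)
    exact_mod_cast sub_neg.1 h1
  · right
    filter_upwards [h.eventually_const_lt hx] with n hn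
    have h1 := pos_of_mul_pos_right hn (by positivity)
    exact_mod_cast sub_pos.1 h1

/-- The pair counts of two vertices are eventually in a fixed strict order. -/
theorem ae_eventually_lt_or [IsProbabilityMeasure μ] (hA : IsUniformAttachment μ A) {u v : ℕ}
    (hu : 1 ≤ u) (huv : u < v) :
    ∀ᵐ ω ∂μ, (∀ᶠ n in atTop, pairCount (SameBranch (fun k => A k ω) v) n <
        pairCount (SameBranch (fun k => A k ω) u) n) ∨
      ∀ᶠ n in atTop, pairCount (SameBranch (fun k => A k ω) u) n <
        pairCount (SameBranch (fun k => A k ω) v) n := by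
  have hY := (isAveraging_sameBranch hA (v := v) (by omega)).sub
    ((isAveraging_sameBranch hA hu).mono huv.le)
  obtain ⟨X, hXm, hX⟩ := hY.exists_tendsto
  let P : ℕ → ℕ → ℕ → ℝ → ℕ → (ℕ → ℕ) → Prop := fun w₁ w₂ j c n a =>
    v ≤ n ∧ a w₁ = v ∧ a w₂ = v ∧ a j = u ∧ c * n ≤ subtreeSize a (w₁ + 1) n ∧
      c * n ≤ subtreeSize a (w₂ + 1) n ∧ c * n ≤ subtreeSize a (j + 1) n
  -- The children and the proportion `1 / (N + 1)` range over countable sets, so one null set serves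
  -- all choices. The bounds `w₁, w₂, j < n` make the event depend on the tree on `[n]` only.
  have key : ∀ w₁ w₂ j N : ℕ, ∀ᵐ ω ∂μ, v ≤ w₁ → v ≤ w₂ → v ≤ j → w₁ ≠ w₂ →
      (∃ᶠ n in atTop, (w₁ < n ∧ w₂ < n ∧ j < n) ∧
        P w₁ w₂ j (1 / ((N : ℝ) + 1)) n fun k => A k ω) → X ω ≠ 0 := by
    intro w₁ w₂ j N
    by_cases hw : v ≤ w₁ ∧ v ≤ w₂ ∧ v ≤ j ∧ w₁ ≠ w₂
    swap
    · exact Eventually.of_forall fun ω a1 a2 a3 a4 => absurd ⟨a1, a2, a3, a4⟩ hw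
    obtain ⟨h₁, h₂, hj, hne⟩ := hw
    have hmain := hY.ae_limit_ne_zero (K := 16) (by norm_num)
      (smallSteps_pairDensity_sub u v (by omega)) hXm hX
      (c := (1 / ((N : ℝ) + 1)) ^ 3 / 72) (by positivity)
      (G := fun n => {ω | (w₁ < n ∧ w₂ < n ∧ j < n) ∧
        P w₁ w₂ j (1 / ((N : ℝ) + 1)) n fun k => A k ω}) ?_ ?_ ?_
    · filter_upwards [hmain] with ω hω _ _ _ _ hf
      exact hω hf
    · intro n
      by_cases hlt : w₁ < n ∧ w₂ < n ∧ j < n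
      · refine measurableSet_history hA
          (p := fun a => (w₁ < n ∧ w₂ < n ∧ j < n) ∧ P w₁ w₂ j (1 / ((N : ℝ) + 1)) n a) ?_
        intro a b hab
        simp only [P]
        rw [hab w₁ (by omega) hlt.1, hab w₂ (by omega) hlt.2.1, hab j (by omega) hlt.2.2,
          subtreeSize_congr (by omega) hab, subtreeSize_congr (by omega) hab,
          subtreeSize_congr (by omega) hab]
      · simp [hlt]
    · exact fun n ω hω => hω.2.1
    · intro n k hnk hk
      filter_upwards [hA.ae_isAttachment] with ω ha hω
      obtain ⟨-, -, e₁, e₂, e₃, e₄, e₅, e₆⟩ := hω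
      exact le_stepVar_pairDensity_sub (by positivity) ha hu huv h₁ h₂ hj hne e₁ e₂ e₃ e₄ e₅ e₆
        hnk hk
  have hpos := ae_all_iff.2 fun w : ℕ => ae_exists_subtreeSize_ge hA (w := w + 1) (by omega)
  filter_upwards [ae_all_iff.2 fun w₁ => ae_all_iff.2 fun w₂ => ae_all_iff.2 fun j =>
    ae_all_iff.2 fun N => key w₁ w₂ j N, hpos, hX, ae_frequently_attach hA hu,
    ae_frequently_attach hA (v := v) (by omega)] with ω hkey hpos hX hfu hfv
  refine eventually_lt_or_of_limit_ne_zero hX ?_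
  rw [frequently_atTop] at hfu hfv
  obtain ⟨j, hj, ej⟩ := hfu v
  obtain ⟨w₁, h₁, e₁⟩ := hfv v
  obtain ⟨w₂, h₂, e₂⟩ := hfv (w₁ + 1)
  obtain ⟨c₁, p₁, l₁⟩ := hpos w₁
  obtain ⟨c₂, p₂, l₂⟩ := hpos w₂
  obtain ⟨c₃, p₃, l₃⟩ := hpos j
  obtain ⟨N, hN⟩ := exists_nat_one_div_lt (lt_min p₁ (lt_min p₂ p₃))
  rw [lt_min_iff, lt_min_iff] at hN
  refine hkey w₁ w₂ j N h₁ (by omega) hj (by omega) (Eventually.frequently ?_)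
  filter_upwards [l₁, l₂, l₃, eventually_ge_atTop (v + w₁ + w₂ + j + 1)] with n i₁ i₂ i₃ hn
  refine ⟨by omega, by omega, e₁, e₂, ej, le_trans ?_ i₁, le_trans ?_ i₂, le_trans ?_ i₃⟩
  · gcongr; exact hN.1.le
  · gcongr; exact hN.2.1.le
  · gcongr; exact hN.2.2.le

end URRT

namespace URRT

open Finset MeasureTheory ProbabilityTheory Filter Topology

/-! ### The center -/

theorem centerIndex_spec {n : ℕ} (hn : 1 ≤ n) (ψ : Vertex n → ℕ) :
    ∃ u : Vertex n, (u : ℕ) = centerIndex ψ ∧ ∀ v, ψ v ≤ ψ u := by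
  have h := (existsUnique_rank_eq_one hn ψ).exists
  refine ⟨h.choose, by rw [centerIndex, dif_pos h], fun v => ?_⟩
  have h1 := (rank_eq_one_iff ψ _).1 h.choose_spec v
  unfold MoreCentral at h1
  omega

theorem centerIndex_betweenness_spec {a : ℕ → ℕ} (ha : IsAttachment a) {n : ℕ} (hn : 1 ≤ n) :
    ∃ u : Vertex n, (u : ℕ) = centerIndex (betweenness (tree a n)) ∧
      ∀ v : Vertex n, betweenness (tree a n) v ≤ betweenness (tree a n) u ∧
        pairCount (SameBranch a u) n ≤ pairCount (SameBranch a v) n := by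
  obtain ⟨u, hu, h⟩ := centerIndex_spec hn (betweenness (tree a n))
  refine ⟨u, hu, fun v => ⟨h v, ?_⟩⟩
  have h1 := h v
  have h2 := betweenness_add_pairCount ha u
  have h3 := betweenness_add_pairCount ha v
  omega

/-- The center is eventually constant as soon as the root has two large branches, large labels
have small subtrees, and the scores of any two vertices are eventually in a fixed strict order. -/
theorem exists_eventually_centerIndex_eq {a : ℕ → ℕ} (ha : IsAttachment a)
    (hchild : ∃ᶠ n in atTop, a n = 1)
    (hpos : ∀ w, 1 ≤ w → ∃ c : ℝ, 0 < c ∧ ∀ᶠ n : ℕ in atTop, c * n ≤ subtreeSize a w n)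
    (htail : ∀ ε : ℝ, 0 < ε → ∃ M, 1 ≤ M ∧ ∀ᶠ n : ℕ in atTop, ∀ w, M ≤ w →
      (subtreeSize a w n : ℝ) ≤ ε * n)
    (hcmp : ∀ u v, 1 ≤ u → u < v →
      (∀ᶠ n in atTop, pairCount (SameBranch a v) n < pairCount (SameBranch a u) n) ∨
        ∀ᶠ n in atTop, pairCount (SameBranch a u) n < pairCount (SameBranch a v) n) :
    ∃ K, ∀ᶠ n in atTop, centerIndex (betweenness (tree a n)) = K := by
  obtain ⟨M, -, hM⟩ : ∃ M, 1 ≤ M ∧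
      ∀ᶠ n in atTop, centerIndex (betweenness (tree a n)) < M := by
    rw [frequently_atTop] at hchild
    obtain ⟨w₁, h₁, e₁⟩ := hchild 1
    obtain ⟨w₂, h₂, e₂⟩ := hchild (w₁ + 1)
    obtain ⟨c₁, p₁, l₁⟩ := hpos (w₁ + 1) (by omega)
    obtain ⟨c₂, p₂, l₂⟩ := hpos (w₂ + 1) (by omega)
    -- With `c₁ c₂ / 4`, a label at least `M` has betweenness at most `c₁ c₂ n^2 / 2`, whereas the
    -- root has at least `c₁ c₂ n^2`.
    obtain ⟨M, hM1, hM⟩ := htail (c₁ * c₂ / 4) (by positivity)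
    refine ⟨M, hM1, ?_⟩
    filter_upwards [l₁, l₂, hM, eventually_ge_atTop 1] with n i₁ i₂ hM hn
    obtain ⟨u, hu, h⟩ := centerIndex_betweenness_spec ha hn
    rw [← hu]
    by_contra hlt
    have h3 := hM u (not_lt.1 hlt)
    have h1n : 1 ∈ Icc 1 n := mem_Icc.2 ⟨le_rfl, hn⟩
    have h4 : subtreeSize a (w₁ + 1) n * subtreeSize a (w₂ + 1) n ≤ 2 * n * subtreeSize a u n :=
      (le_betweenness_one ha h1n h₁ (by omega) e₁ e₂ (by omega)).trans
        ((h ⟨1, h1n⟩).1.trans (betweenness_le ha u))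
    have h5 : (subtreeSize a (w₁ + 1) n : ℝ) * subtreeSize a (w₂ + 1) n ≤
        2 * n * subtreeSize a u n := by exact_mod_cast h4
    have hn0 : (0 : ℝ) < n := by exact_mod_cast hn
    have h6 : c₁ * n * (c₂ * n) ≤ 2 * n * (c₁ * c₂ / 4 * n) :=
      calc c₁ * n * (c₂ * n) ≤ (subtreeSize a (w₁ + 1) n : ℝ) * subtreeSize a (w₂ + 1) n := by
            gcongr
        _ ≤ 2 * n * subtreeSize a u n := h5
        _ ≤ _ := by gcongr
    have h7 : 0 < c₁ * n * (c₂ * n) := by positivity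
    linarith
  let P : ℕ → ℕ → Prop := fun u v =>
    ∀ᶠ n in atTop, pairCount (SameBranch a u) n < pairCount (SameBranch a v) n
  have hP : ∀ u v, 1 ≤ u → 1 ≤ v → u ≠ v → P u v ∨ P v u := by
    intro u v hu hv huv
    rcases Nat.lt_or_gt_of_ne huv with h | h
    · exact (hcmp u v hu h).symm
    · exact hcmp v u hv h
  have hstable : ∀ᶠ n in atTop, ∀ u ∈ range M, ∀ v ∈ range M, P u v →
      pairCount (SameBranch a u) n < pairCount (SameBranch a v) n := by
    rw [eventually_all_finset]
    intro u _
    rw [eventually_all_finset]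
    intro v _
    by_cases h : P u v
    · filter_upwards [h] with n hn _ using hn
    · exact Eventually.of_forall fun n h' => absurd h' h
  have hbest : ∀ᶠ n in atTop, centerIndex (betweenness (tree a n)) < M ∧
      1 ≤ centerIndex (betweenness (tree a n)) ∧
      ∀ v, 1 ≤ v → v < M → v ≠ centerIndex (betweenness (tree a n)) →
        P (centerIndex (betweenness (tree a n))) v := by
    filter_upwards [hM, hstable, eventually_ge_atTop (M + 1)] with n hM hs hn
    obtain ⟨u, hu, h⟩ := centerIndex_betweenness_spec ha (n := n) (by omega)
    have hu1 := (mem_Icc.1 u.2).1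
    rw [← hu] at hM ⊢
    refine ⟨hM, hu1, fun v hv hvM hne => (hP v u hv hu1 hne).resolve_left fun hvu => ?_⟩
    have h1 := hs v (mem_range.2 hvM) u (mem_range.2 hM) hvu
    have h2 := (h ⟨v, mem_Icc.2 ⟨hv, by omega⟩⟩).2
    simp only at h2
    omega
  -- Each late center eventually beats every other label below `M`; two different ones would beat
  -- each other at a common time. Transitivity of `P` is not needed.
  obtain ⟨n₁, hn₁⟩ := hbest.exists
  refine ⟨centerIndex (betweenness (tree a n₁)), ?_⟩
  filter_upwards [hbest] with n hn
  by_contra hne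
  obtain ⟨m, h1, h2⟩ := ((hn.2.2 _ hn₁.2.1 hn₁.1 (Ne.symm hne)).and
    (hn₁.2.2 _ hn.2.1 hn.1 hne)).exists
  omega

/-! ### Measurability of the center and persistence -/

theorem tree_congr {a b : ℕ → ℕ} {n : ℕ} (hab : ∀ k, 1 ≤ k → k < n → a k = b k) :
    tree a n = tree b n := by
  have key : ∀ x y : Vertex n, (∃ m : ℕ, 1 ≤ m ∧ (x : ℕ) = a m ∧ (y : ℕ) = m + 1) ↔
      ∃ m : ℕ, 1 ≤ m ∧ (x : ℕ) = b m ∧ (y : ℕ) = m + 1 := by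
    intro x y
    refine exists_congr fun m => and_congr_right fun hm => and_congr_left fun h => ?_
    rw [hab m hm (by have := (mem_Icc.1 y.2).2; omega)]
  ext x y
  rw [tree_adj, tree_adj, key x y, key y x]

/-- A sequence of discrete random variables that is almost surely eventually constant is
persistent. -/
theorem persistent_of_ae_eventually {Ω : Type*} [MeasurableSpace Ω] {μ : Measure Ω}
    {I : ℕ → Ω → ℕ} (hI : ∀ n, Measurable (I n))
    (h : ∀ᵐ ω ∂μ, ∃ K, ∀ᶠ n in atTop, I n ω = K) : Persistent μ I := by
  classical
  let p : Ω → ℕ → Prop := fun ω N => ∀ n, N ≤ n → I n ω = I N ω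
  have hp : ∀ N, MeasurableSet {ω | p ω N} := by
    intro N
    have : {ω | p ω N} = ⋂ n, ⋂ (_ : N ≤ n), {ω | I n ω = I N ω} := by
      ext ω; simp [p]
    rw [this]
    exact MeasurableSet.iInter fun n => MeasurableSet.iInter fun _ =>
      measurableSet_eq_fun (hI n) (hI N)
  have hE : MeasurableSet {ω | ∃ N, p ω N} := by
    have : {ω | ∃ N, p ω N} = ⋃ N, {ω | p ω N} := by ext ω; simp
    rw [this]
    exact MeasurableSet.iUnion hp
  -- The second alternative makes `Nat.find` total: it returns `0` where the sequence never
  -- stabilises.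
  let q : Ω → ℕ → Prop := fun ω N => p ω N ∨ ¬ ∃ N, p ω N
  have hq : ∀ ω, ∃ N, q ω N := fun ω => by
    by_cases hω : ∃ N, p ω N
    · exact hω.imp fun _ => Or.inl
    · exact ⟨0, Or.inr hω⟩
  have hN : Measurable fun ω => Nat.find (hq ω) :=
    measurable_find hq fun N => (hp N).union hE.compl
  refine ⟨fun ω => Nat.find (hq ω), fun ω => I (Nat.find (hq ω)) ω, hN, ?_, ?_⟩
  · refine measurable_to_countable' fun k => ?_
    have : (fun ω => I (Nat.find (hq ω)) ω) ⁻¹' {k} =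
        ⋃ j, (fun ω => Nat.find (hq ω)) ⁻¹' {j} ∩ I j ⁻¹' {k} := by
      ext ω; simp
    rw [this]
    exact MeasurableSet.iUnion fun j => (hN (measurableSet_singleton j)).inter
      (hI j (measurableSet_singleton k))
  · filter_upwards [h] with ω hω n hn
    obtain ⟨K, hK⟩ := hω
    obtain ⟨N, hN⟩ := eventually_atTop.1 hK
    have hex : ∃ N, p ω N := ⟨N, fun n hn => (hN n hn).trans (hN N le_rfl).symm⟩
    exact (Nat.find_spec (hq ω)).resolve_right (not_not.2 hex) n hn

end URRT

theorem mainTheorem7 {Ω : Type*} [MeasurableSpace Ω] (μ : MeasureTheory.Measure Ω)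
    [MeasureTheory.IsProbabilityMeasure μ] (A : ℕ → Ω → ℕ)
    (hA : URRT.IsUniformAttachment μ A) :
    URRT.Persistent μ fun n ω =>
      URRT.centerIndex (URRT.betweenness (URRT.tree (fun m => A m ω) n)) := by
  open URRT MeasureTheory in
  refine persistent_of_ae_eventually (fun n => ?_) ?_
  · exact (measurable_history hA (n := n) (f := fun a => centerIndex (betweenness (tree a n)))
      fun a b hab => by rw [tree_congr hab]).mono ((history hA).le n) le_rfl
  -- Labels are shifted to `w + 1`, `u + 1` and `u + 1 + d + 1`, so the constraints `1 ≤ u < v` hold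
  -- automatically under the countable quantifiers.
  · have hpos := ae_all_iff.2 fun w : ℕ => ae_exists_subtreeSize_ge hA (w := w + 1) (by omega)
    have hcmp := ae_all_iff.2 fun u : ℕ => ae_all_iff.2 fun d : ℕ =>
      ae_eventually_lt_or hA (u := u + 1) (v := u + 1 + d + 1) (by omega) (by omega)
    filter_upwards [hA.ae_isAttachment, ae_frequently_attach hA le_rfl,
      ae_exists_subtreeSize_le hA, hpos, hcmp] with ω ha hchild htail hpos hcmp
    refine exists_eventually_centerIndex_eq ha hchild (fun w hw => ?_) htail fun u v hu huv => ?_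
    · obtain ⟨w, rfl⟩ : ∃ k, w = k + 1 := ⟨w - 1, by omega⟩
      exact hpos w
    · obtain ⟨u, rfl⟩ : ∃ k, u = k + 1 := ⟨u - 1, by omega⟩
      obtain ⟨d, rfl⟩ : ∃ d, v = u + 1 + d + 1 := ⟨v - (u + 1) - 1, by omega⟩
      exact hcmp u d
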